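/- Let $q\ge 1$, $m>0$ and $\kappa>0$ be real numbers. For measurable $\rho:\mathbb{R}^3\to\mathbb{R}$ with $0\le\rho\in L^1\cap L^{5/3}(\mathbb{R}^3)$ put $$\mathcal{E}_\infty(\rho)=\int_{\mathbb{R}^3} j_\infty(\rho(x))\,dx-\frac{\kappa}{2}\int_{\mathbb{R}^3}\int_{\mathbb{R}^3}\frac{\rho(x)\rho(y)}{|x-y|}\,dx\,dy,$$ where $$j_\infty(r)=\frac{q}{8\pi^3}\int_{\{p\in\mathbb{R}^3:\,|p|<(6\pi^2 r/q)^{1/3}\}}\frac{|p|^2}{2m}\,dp=\frac{3}{10m}\Big(\frac{6\pi^2}{q}\Big)^{2/3}r^{5/3}\qquad(r\ge 0),$$ and for $N>0$ let $$E_\infty(N)=\inf\Big\{\mathcal{E}_\infty(\rho):\ 0\le\rho\in L^1\cap L^{5/3}(\mathbb{R}^3),\ \int_{\mathbb{R}^3}\rho(x)\,dx=N\Big\}.$$ Then for every $N>0$ the problem $E_\infty(N)$ has at least one minimizer: there is $0\le\rho_\infty\in L^1\cap L^{5/3}(\mathbb{R}^3)$ with $\int_{\mathbb{R}^3}\rho_\infty(x)\,dx=N$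 and $\mathcal{E}_\infty(\rho_\infty)=E_\infty(N)$. -/

import Mathlib

open MeasureTheory
open scoped ENNReal

namespace NeutronStar

/-- Three-dimensional Euclidean space, used both for positions `x` and for momenta `p`. -/
abbrev R3 : Type := EuclideanSpace ℝ (Fin 3)

/-- The Fermi momentum `η = (6 π² r / q)^(1/3)` at density `r`. -/
noncomputable def fermiMomentum (q r : ℝ) : ℝ :=
  (6 * Real.pi ^ 2 * r / q) ^ (1 / 3 : ℝ)

/-- The semiclassical nonrelativistic kinetic energy density at density `r`:
`j_∞(r) = q / (8 π³) ∫_{|p| < η} |p|² / (2 m) dp`. -/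
noncomputable def kineticDensity (q m r : ℝ) : ℝ :=
  q / (8 * Real.pi ^ 3) *
    ∫ p in Metric.ball (0 : R3) (fermiMomentum q r), ‖p‖ ^ 2 / (2 * m)

/-- The Newtonian self-energy `D(ρ, ρ) = 1/2 ∫∫ ρ(x) ρ(y) / |x - y| dx dy`. -/
noncomputable def selfEnergy (ρ : R3 → ℝ) : ℝ :=
  1 / 2 * ∫ x, ∫ y, ρ x * ρ y / ‖x - y‖

/-- The limit energy functional `∫ j_∞(ρ(x)) dx - κ D(ρ, ρ)`. -/
noncomputable def energy (q m κ : ℝ) (ρ : R3 → ℝ) : ℝ :=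
  (∫ x, kineticDensity q m (ρ x)) - κ * selfEnergy ρ

/-- Admissible densities of total mass `N`: `0 ≤ ρ ∈ L¹ ∩ L^{5/3}(ℝ³)` with `∫ ρ = N`. -/
structure IsAdmissible (N : ℝ) (ρ : R3 → ℝ) : Prop where
  nonneg : ∀ᵐ x : R3, 0 ≤ ρ x
  integrable : Integrable ρ
  memLp : MemLp ρ (5 / 3 : ℝ≥0∞)
  mass : ∫ x, ρ x = N

/-- The ground state energy `E_∞(N)`, an infimum in the extended reals (so that it is `⊥` when
the functional is unbounded below). -/
noncomputable def groundEnergy (q m κ N : ℝ) : EReal :=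
  ⨅ (ρ : R3 → ℝ) (_ : IsAdmissible N ρ), ((energy q m κ ρ : ℝ) : EReal)

/-- `ρ` is a minimizer of the problem `E_∞(N)`: it is admissible and attains the infimum. -/
def IsMinimizer (q m κ N : ℝ) (ρ : R3 → ℝ) : Prop :=
  IsAdmissible N ρ ∧ ((energy q m κ ρ : ℝ) : EReal) = groundEnergy q m κ N

end NeutronStar

open MeasureTheory Filter Topology Set
open scoped ENNReal Convolution

namespace NeutronStar

/-! Relax the constraint to mass at most `N`. Young's inequality for the Newtonian kernel lets the
kinetic energy absorb the interaction (`exists_coercive`), so minimizing sequences have bounded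
kinetic energy. They may be taken radially decreasing (`exists_radially_decreasing_lt`). Mass and
kinetic bounds then give a common majorant, of order `|x|^(-9/5)` near the origin and `|x|^(-3)` far
away, whose Coulomb energy is finite. Helly's theorem yields an a.e. convergent subsequence; the
interaction passes to the limit by dominated convergence, mass and kinetic energy by Fatou, and the
limit solves the relaxed problem (`exists_relaxed_minimizer`).

No mass is lost (`exists_minimizer`): spreading out a ball makes the energy negative, and dilating a
density of negative energy lowers the energy further, so a relaxed minimizer of mass below `N` could
be improved.

The rearrangement step (`exists_radially_decreasing`) rests on polarization. Reflecting in a plane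
that misses the origin and moving the larger of two mirror values inward preserves mass and kinetic
energy and does not decrease the interaction. In a compact class of continuous functions stable
under polarization, a minimizer of the second moment is already ordered by every such reflection,
hence radially decreasing. -/

/-! ### Young's inequality for the Newtonian kernel -/

theorem integrable_radial_power {p q : ℝ} (hp : p < 3) (hq : 3 < q) :
    Integrable (fun x : R3 => if ‖x‖ < 1 then ‖x‖ ^ (-p) else ‖x‖ ^ (-q)) := by
  have h := (integrable_fun_norm_addHaar (E := R3) (volume : Measure R3)
    (f := fun r : ℝ => if r < 1 then r ^ (-p) else r ^ (-q))).2 ?_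
  · exact h
  · have hd : Module.finrank ℝ R3 - 1 = 2 := by simp
    rw [hd]
    have hu : Ioi (0 : ℝ) = Ioc 0 1 ∪ Ioi 1 := by
      rw [Ioc_union_Ioi_eq_Ioi]; norm_num
    rw [hu]
    refine IntegrableOn.union ?_ ?_
    · have h1 : IntegrableOn (fun y : ℝ => y ^ (2 - p)) (Ioc 0 1) := by
        rw [← intervalIntegrable_iff_integrableOn_Ioc_of_le zero_le_one]
        exact intervalIntegral.intervalIntegrable_rpow' (by linarith)
      rw [integrableOn_Ioc_iff_integrableOn_Ioo] at h1 ⊢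
      refine h1.congr_fun (fun y hy => ?_) measurableSet_Ioo
      simp only [hy.2, if_true, smul_eq_mul]
      rw [← Real.rpow_natCast, ← Real.rpow_add hy.1]
      norm_num [sub_eq_add_neg]
    · have h1 : IntegrableOn (fun y : ℝ => y ^ (2 - q)) (Ioi 1) :=
        integrableOn_Ioi_rpow_of_lt (by linarith) zero_lt_one
      refine h1.congr_fun (fun y hy => ?_) measurableSet_Ioi
      have hy1 : (1 : ℝ) < y := hy
      simp only [not_lt.2 hy1.le, if_false, smul_eq_mul]
      rw [← Real.rpow_natCast, ← Real.rpow_add (by linarith)]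
      norm_num [sub_eq_add_neg]

/-- A weight dominating the powers of the Newtonian kernel that are needed in Young's
inequality near the singularity and at infinity. -/
noncomputable def kernelWeight (x : R3) : ℝ :=
  if ‖x‖ < 1 then ‖x‖ ^ (-(5 / 2) : ℝ) else ‖x‖ ^ (-4 : ℝ)

theorem integrable_kernelWeight : Integrable kernelWeight :=
  integrable_radial_power (by norm_num) (by norm_num)

theorem kernelWeight_nonneg (x : R3) : 0 ≤ kernelWeight x := by
  unfold kernelWeight; split_ifs <;> positivity

theorem kernelWeight_sub_comm (x y : R3) : kernelWeight (x - y) = kernelWeight (y - x) := by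
  unfold kernelWeight; rw [norm_sub_rev]

theorem mul_le_rpow_add_rpow {a b p q : ℝ} (ha : 0 ≤ a) (hb : 0 ≤ b) (hpq : p.HolderConjugate q) :
    a * b ≤ a ^ p + b ^ q := by
  have h := Real.young_inequality_of_nonneg ha hb hpq
  have h1 : a ^ p / p ≤ a ^ p := div_le_self (by positivity) hpq.lt.le
  have h2 : b ^ q / q ≤ b ^ q := div_le_self (by positivity) hpq.symm.lt.le
  linarith

/-- Young with exponents `(5/3, 5/2)` inside the unit ball and `(4/3, 4)` outside: the dual powers
satisfy `5/2 < 3 < 4`, which is what makes `kernelWeight` integrable. -/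
theorem div_norm_le {t : ℝ} (ht : 0 ≤ t) (x : R3) :
    t / ‖x‖ ≤ t ^ (5 / 3 : ℝ) + t ^ (4 / 3 : ℝ) + kernelWeight x := by
  have h1 : (0 : ℝ) ≤ t ^ (5 / 3 : ℝ) := by positivity
  have h2 : (0 : ℝ) ≤ t ^ (4 / 3 : ℝ) := by positivity
  have hx : (0 : ℝ) ≤ ‖x‖⁻¹ := by positivity
  rw [div_eq_mul_inv]
  unfold kernelWeight
  split_ifs
  · have h := mul_le_rpow_add_rpow ht hx (p := 5 / 3) (q := 5 / 2)
      (Real.holderConjugate_iff.2 (by norm_num))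
    rw [Real.inv_rpow (norm_nonneg _), ← Real.rpow_neg (norm_nonneg _)] at h
    linarith
  · have h := mul_le_rpow_add_rpow ht hx (p := 4 / 3) (q := 4)
      (Real.holderConjugate_iff.2 (by norm_num))
    rw [Real.inv_rpow (norm_nonneg _), ← Real.rpow_neg (norm_nonneg _)] at h
    linarith

/-- The parameter `s` puts an arbitrarily small factor on the kinetic power `t^(5/3)`; this is the
source of coercivity. Outside the unit ball the kernel is at most 1. -/
theorem div_norm_le_of_pos {s : ℝ} (hs : 0 < s) {t : ℝ} (ht : 0 ≤ t) (x : R3) :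
    t / ‖x‖ ≤ s * t ^ (5 / 3 : ℝ) + s ^ (-(3 / 2) : ℝ) * kernelWeight x + t := by
  have h1 : (0 : ℝ) ≤ s * t ^ (5 / 3 : ℝ) := by positivity
  have hx : (0 : ℝ) ≤ ‖x‖⁻¹ := by positivity
  by_cases hx1 : ‖x‖ < 1
  · have h := mul_le_rpow_add_rpow (a := s ^ (3 / 5 : ℝ) * t) (b := s ^ (-(3 / 5) : ℝ) * ‖x‖⁻¹)
      (by positivity) (by positivity) (p := 5 / 3) (q := 5 / 2)
      (Real.holderConjugate_iff.2 (by norm_num))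
    rw [Real.mul_rpow (by positivity) ht, Real.mul_rpow (by positivity) hx,
      ← Real.rpow_mul hs.le, ← Real.rpow_mul hs.le,
      Real.inv_rpow (norm_nonneg _), ← Real.rpow_neg (norm_nonneg _)] at h
    have h3 : s ^ (3 / 5 : ℝ) * t * (s ^ (-(3 / 5) : ℝ) * ‖x‖⁻¹) = t / ‖x‖ := by
      rw [div_eq_mul_inv, mul_mul_mul_comm, ← Real.rpow_add hs]
      simp [div_eq_mul_inv]
    rw [h3] at h
    norm_num at h
    unfold kernelWeight
    rw [if_pos hx1]
    norm_num
    linarith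
  · have h2 : t / ‖x‖ ≤ t := div_le_self ht (not_lt.1 hx1)
    have h3 : 0 ≤ s ^ (-(3 / 2) : ℝ) * kernelWeight x :=
      mul_nonneg (by positivity) (kernelWeight_nonneg x)
    linarith

/-! ### Finiteness and continuity of the interaction energy -/

/-- The integrand of the Newtonian interaction energy. -/
noncomputable def coulombIntegrand (u : R3 → ℝ) (p : R3 × R3) : ℝ :=
  u p.1 * u p.2 / ‖p.1 - p.2‖

/-- Twice the Newtonian self-energy, as an integral over the product space. -/
noncomputable def coulomb (u : R3 → ℝ) : ℝ := ∫ p, coulombIntegrand u p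

theorem coulombIntegrand_nonneg {u : R3 → ℝ} (h0 : ∀ x, 0 ≤ u x) (p : R3 × R3) :
    0 ≤ coulombIntegrand u p :=
  div_nonneg (mul_nonneg (h0 _) (h0 _)) (norm_nonneg _)

theorem measurable_coulombIntegrand {u : R3 → ℝ} (hu : Measurable u) :
    Measurable (coulombIntegrand u) := by
  unfold coulombIntegrand
  fun_prop

theorem integrable_mul_kernelWeight {f : R3 → ℝ} (hf : Integrable f) :
    Integrable (fun p : R3 × R3 => f p.1 * kernelWeight (p.1 - p.2)) := by
  have h := Integrable.convolution_integrand (ContinuousLinearMap.mul ℝ ℝ) hf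
    integrable_kernelWeight
  have h2 := h.swap
  refine h2.congr (Eventually.of_forall fun p => ?_)
  simp only [Function.comp, Prod.swap, ContinuousLinearMap.mul_apply']
  rw [kernelWeight_sub_comm]

/-- All three exponents lie strictly between 1 and 5/3, so that the lemma also covers
`radialMajorant`, for which both endpoints fail. For values `b ≤ a` one has `ab ≤ a^(6/5) b^(4/5)`,
and `div_norm_le` at `t = b^(4/5)` produces the powers `4/3` and `16/15`; adding the swapped bound
covers both orderings. -/
theorem integrable_coulombIntegrand {u : R3 → ℝ} (hu : Measurable u) (h0 : ∀ x, 0 ≤ u x)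
    (h1 : Integrable fun x => u x ^ (6 / 5 : ℝ)) (h2 : Integrable fun x => u x ^ (4 / 3 : ℝ))
    (h3 : Integrable fun x => u x ^ (16 / 15 : ℝ)) : Integrable (coulombIntegrand u) := by
  have key : Integrable (fun p : R3 × R3 => u p.1 ^ (6 / 5 : ℝ) * u p.2 ^ (4 / 3 : ℝ)
      + u p.1 ^ (6 / 5 : ℝ) * u p.2 ^ (16 / 15 : ℝ)
      + u p.1 ^ (6 / 5 : ℝ) * kernelWeight (p.1 - p.2)) :=
    ((h1.mul_prod h2).add (h1.mul_prod h3)).add (integrable_mul_kernelWeight h1)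
  refine (key.add key.swap).mono' (measurable_coulombIntegrand hu).aestronglyMeasurable
    (Eventually.of_forall fun p => ?_)
  have main : ∀ a b : ℝ, 0 ≤ b → b ≤ a → ∀ x : R3, a * b / ‖x‖ ≤
      a ^ (6 / 5 : ℝ) * b ^ (4 / 3 : ℝ) + a ^ (6 / 5 : ℝ) * b ^ (16 / 15 : ℝ)
      + a ^ (6 / 5 : ℝ) * kernelWeight x := by
    intro a b hb hab x
    have ha := hb.trans hab
    have h5 : a * b ≤ a ^ (6 / 5 : ℝ) * b ^ (4 / 5 : ℝ) := by
      have e1 : a ^ (6 / 5 : ℝ) = a * a ^ (1 / 5 : ℝ) := by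
        rw [← Real.rpow_one_add' ha (by norm_num)]; norm_num
      have e2 : b = b ^ (1 / 5 : ℝ) * b ^ (4 / 5 : ℝ) := by
        rw [← Real.rpow_add' hb (by norm_num)]; norm_num
      have e3 : b ^ (1 / 5 : ℝ) ≤ a ^ (1 / 5 : ℝ) := Real.rpow_le_rpow hb hab (by norm_num)
      calc a * b = a * b ^ (1 / 5 : ℝ) * b ^ (4 / 5 : ℝ) := by rw [mul_assoc, ← e2]
        _ ≤ a * a ^ (1 / 5 : ℝ) * b ^ (4 / 5 : ℝ) := by gcongr
        _ = _ := by rw [e1]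
    have h6 := div_norm_le (t := b ^ (4 / 5 : ℝ)) (by positivity) x
    rw [← Real.rpow_mul hb, ← Real.rpow_mul hb] at h6
    norm_num at h6
    calc a * b / ‖x‖ ≤ a ^ (6 / 5 : ℝ) * b ^ (4 / 5 : ℝ) / ‖x‖ := by gcongr
      _ = a ^ (6 / 5 : ℝ) * (b ^ (4 / 5 : ℝ) / ‖x‖) := by ring
      _ ≤ a ^ (6 / 5 : ℝ) * (b ^ (4 / 3 : ℝ) + b ^ (16 / 15 : ℝ) + kernelWeight x) := by
        gcongr
      _ = _ := by ring
  have pos : ∀ a b : ℝ, 0 ≤ a → 0 ≤ b → ∀ x : R3, 0 ≤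
      a ^ (6 / 5 : ℝ) * b ^ (4 / 3 : ℝ) + a ^ (6 / 5 : ℝ) * b ^ (16 / 15 : ℝ)
      + a ^ (6 / 5 : ℝ) * kernelWeight x := by
    intro a b ha hb x
    have := kernelWeight_nonneg x
    positivity
  rw [Real.norm_of_nonneg (coulombIntegrand_nonneg h0 p)]
  simp only [Pi.add_apply, Function.comp, Prod.fst_swap, Prod.snd_swap]
  unfold coulombIntegrand
  rcases le_total (u p.2) (u p.1) with h | h
  · have := main _ _ (h0 p.2) h (p.1 - p.2)
    have := pos _ _ (h0 p.2) (h0 p.1) (p.2 - p.1)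
    linarith
  · have := main _ _ (h0 p.1) h (p.2 - p.1)
    have := pos _ _ (h0 p.1) (h0 p.2) (p.1 - p.2)
    rw [mul_comm, norm_sub_rev]
    linarith

theorem integrable_rpow_of_le {u : R3 → ℝ} (hu : Measurable u) (h0 : ∀ x, 0 ≤ u x)
    (h1 : Integrable u) (h2 : Integrable fun x => u x ^ (5 / 3 : ℝ)) {a : ℝ} (ha : 1 ≤ a)
    (ha' : a ≤ 5 / 3) : Integrable fun x => u x ^ a := by
  refine (h1.add h2).mono' (hu.pow_const a).aestronglyMeasurable
    (Eventually.of_forall fun x => ?_)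
  have h5 : 0 ≤ u x ^ (5 / 3 : ℝ) := Real.rpow_nonneg (h0 x) _
  rw [Real.norm_of_nonneg (Real.rpow_nonneg (h0 x) _), Pi.add_apply]
  rcases le_total (u x) 1 with h | h
  · have := Real.rpow_le_rpow_of_exponent_ge' (h0 x) h zero_le_one ha
    rw [Real.rpow_one] at this
    linarith
  · have := Real.rpow_le_rpow_of_exponent_le h ha'
    linarith [h0 x]

theorem integrable_coulombIntegrand' {u : R3 → ℝ} (hu : Measurable u) (h0 : ∀ x, 0 ≤ u x)
    (h1 : Integrable u) (h2 : Integrable fun x => u x ^ (5 / 3 : ℝ)) :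
    Integrable (coulombIntegrand u) := by
  apply integrable_coulombIntegrand hu h0 <;>
    exact integrable_rpow_of_le hu h0 h1 h2 (by norm_num) (by norm_num)

theorem coulomb_le {s : ℝ} (hs : 0 < s) {u : R3 → ℝ} (hu : Measurable u) (h0 : ∀ x, 0 ≤ u x)
    (h1 : Integrable u) (h2 : Integrable fun x => u x ^ (5 / 3 : ℝ)) :
    coulomb u ≤ (∫ x, u x) *
      (s * (∫ x, u x ^ (5 / 3 : ℝ)) + s ^ (-(3 / 2) : ℝ) * (∫ x, kernelWeight x) + ∫ x, u x) := by
  have i1 := h1.mul_prod (h2.const_mul s)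
  have i2 := (integrable_mul_kernelWeight h1).mul_const (s ^ (-(3 / 2) : ℝ))
  have i3 := h1.mul_prod h1
  have e2 : ∫ p : R3 × R3, u p.1 * kernelWeight (p.1 - p.2) =
      (∫ x, u x) * ∫ x, kernelWeight x := by
    rw [Measure.volume_eq_prod, integral_prod _ (integrable_mul_kernelWeight h1)]
    simp only [integral_const_mul]
    rw [← integral_mul_const]
    congr 1; ext x
    rw [integral_sub_left_eq_self]
  calc coulomb u ≤ ∫ p : R3 × R3, (u p.1 * (s * u p.2 ^ (5 / 3 : ℝ)) +
        u p.1 * kernelWeight (p.1 - p.2) * s ^ (-(3 / 2) : ℝ) + u p.1 * u p.2) := by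
        refine integral_mono (integrable_coulombIntegrand' hu h0 h1 h2) ((i1.add i2).add i3) ?_
        intro p
        have := mul_le_mul_of_nonneg_left (div_norm_le_of_pos hs (h0 p.2) (p.1 - p.2)) (h0 p.1)
        simp only [coulombIntegrand]
        rw [mul_div_assoc]
        refine this.trans (le_of_eq ?_)
        ring
    _ = _ := by
        have e3 := integral_add (i1.add i2) i3
        have e1 := integral_add i1 i2
        simp only [Pi.add_apply] at e1 e3
        rw [Measure.volume_eq_prod] at *
        rw [e3, e1, integral_mul_const, e2,
          integral_prod_mul (f := u) (g := u),
          integral_prod_mul (f := u) (g := fun x => s * u x ^ (5 / 3 : ℝ)), integral_const_mul]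
        ring

theorem tendsto_coulomb {u : ℕ → R3 → ℝ} {v B : R3 → ℝ} (hu : ∀ n, Measurable (u n))
    (h0 : ∀ n x, 0 ≤ u n x) (hB : ∀ n, ∀ᵐ x, u n x ≤ B x)
    (hF : Integrable (coulombIntegrand B))
    (hlim : ∀ᵐ x, Tendsto (fun n => u n x) atTop (𝓝 (v x))) :
    Tendsto (fun n => coulomb (u n)) atTop (𝓝 (coulomb v)) := by
  refine tendsto_integral_of_dominated_convergence (coulombIntegrand B)
    (fun n => (measurable_coulombIntegrand (hu n)).aestronglyMeasurable) hF
    (fun n => ?_) ?_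
  · rw [Measure.volume_eq_prod]
    filter_upwards [Measure.quasiMeasurePreserving_fst.ae (hB n),
      Measure.quasiMeasurePreserving_snd.ae (hB n)] with p hp1 hp2
    rw [Real.norm_of_nonneg (coulombIntegrand_nonneg (h0 n) p)]
    unfold coulombIntegrand
    have := h0 n p.2
    have := (h0 n p.1).trans hp1
    gcongr
  · rw [Measure.volume_eq_prod]
    filter_upwards [Measure.quasiMeasurePreserving_fst.ae hlim,
      Measure.quasiMeasurePreserving_snd.ae hlim] with p hp1 hp2
    exact (hp1.mul hp2).div_const _

/-! ### Reflections in planes missing the origin -/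

/-- The properties used of the reflection across a plane that does not contain the origin. -/
structure IsAffineReflection (θ : R3 → R3) : Prop where
  isometry : Isometry θ
  involutive : ∀ z, θ (θ z) = z
  measurePreserving : MeasurePreserving θ
  eq_of_norm_eq : ∀ z, ‖z‖ = ‖θ z‖ → θ z = z
  norm_sub_le : ∀ z w, ‖z‖ ≤ ‖θ z‖ → ‖w‖ ≤ ‖θ w‖ → ‖z - w‖ ≤ ‖z - θ w‖

/-- The plane is the perpendicular bisector of `x` and `y`; it misses the origin because the norms
differ. -/
theorem exists_isAffineReflection {x y : R3} (h : ‖x‖ < ‖y‖) :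
    ∃ θ, IsAffineReflection θ ∧ θ x = y := by
  set v := y - x with hv
  set m : R3 := (1 / 2 : ℝ) • (x + y) with hm
  have hv0 : v ≠ 0 := by
    intro h0
    rw [hv, sub_eq_zero] at h0
    simp [h0] at h
  have hvn : 0 < ‖v‖ ^ 2 := by positivity
  -- Signed distance to the plane in units of `‖v‖`; the origin lies on the side `σ < 0`.
  let σ : R3 → ℝ := fun z => inner ℝ v (z - m) / ‖v‖ ^ 2
  have hσ : ∀ z, σ z * ‖v‖ ^ 2 = inner ℝ v (z - m) := fun z => div_mul_cancel₀ _ hvn.ne'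
  let R := (ℝ ∙ v)ᗮ.reflection
  let θ : R3 → R3 := fun z => R (z - m) + m
  have hR : ∀ z, R z = z - (2 * (inner ℝ v z / ‖v‖ ^ 2)) • v := by
    intro z
    simp only [R]
    rw [Submodule.reflection_orthogonal_apply, Submodule.reflection_singleton_apply]
    simp only [RCLike.ofReal_real_eq_id, id]
    module
  have hθ : ∀ z, θ z = z - (2 * σ z) • v := by
    intro z
    simp only [θ, hR, σ]
    abel
  have hvm : 0 < inner ℝ v m := by
    have : inner ℝ v m = (‖y‖ ^ 2 - ‖x‖ ^ 2) / 2 := by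
      rw [hv, hm, real_inner_smul_right, inner_add_right, inner_sub_left, inner_sub_left,
        real_inner_self_eq_norm_sq, real_inner_self_eq_norm_sq, real_inner_comm x y]
      ring
    rw [this]
    have := norm_nonneg x
    nlinarith
  have hnorm : ∀ z, ‖θ z‖ ^ 2 = ‖z‖ ^ 2 - 4 * σ z * inner ℝ v m := by
    intro z
    rw [hθ, norm_sub_sq_real, norm_smul, real_inner_smul_right, real_inner_comm, mul_pow,
      Real.norm_eq_abs, sq_abs]
    have := hσ z
    rw [inner_sub_right] at this
    linear_combination (4 * σ z) * this
  have hH : ∀ z, ‖z‖ ≤ ‖θ z‖ → σ z ≤ 0 := by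
    intro z hz
    have h1 : ‖z‖ ^ 2 ≤ ‖θ z‖ ^ 2 := by gcongr
    rw [hnorm] at h1
    by_contra h2
    have := mul_pos (not_le.1 h2) hvm
    linarith
  have hinv : ∀ z, θ (θ z) = z := by
    intro z
    simp [θ, R, Submodule.reflection_reflection]
  refine ⟨θ, ⟨?_, hinv, ?_, ?_, ?_⟩, ?_⟩
  · exact ((isometry_add_right m).comp R.isometry).comp (IsometryEquiv.subRight m).isometry
  · exact ((measurePreserving_add_right volume m).comp R.measurePreserving).comp
      (measurePreserving_sub_right volume m)
  · intro z hz
    have h1 := hnorm z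
    rw [← hz] at h1
    have h2 : σ z * inner ℝ v m = 0 := by linarith
    have h3 : σ z = 0 := (mul_eq_zero.1 h2).resolve_right hvm.ne'
    rw [hθ, h3]; simp
  · intro z w hz hw
    refine le_of_sq_le_sq ?_ (norm_nonneg _)
    have e : z - θ w = (z - w) + (2 * σ w) • v := by rw [hθ]; abel
    rw [e, norm_add_sq_real, norm_smul, real_inner_smul_right, real_inner_comm, mul_pow,
      Real.norm_eq_abs, sq_abs]
    have e2 : inner ℝ v (z - w) = (σ z - σ w) * ‖v‖ ^ 2 := by
      rw [sub_mul, hσ, hσ, ← inner_sub_right]; congr 1; abel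
    rw [e2]
    have := mul_nonneg (mul_nonneg_of_nonpos_of_nonpos (hH z hz) (hH w hw)) hvn.le
    linarith
  · have h1 : σ x = -(1 / 2) := by
      have : x - m = (-(1 / 2) : ℝ) • v := by rw [hv, hm]; module
      simp only [σ]
      rw [this, real_inner_smul_right, real_inner_self_eq_norm_sq]
      field_simp
    rw [hθ, h1, hv]
    module

/-! ### Polarization -/

/-- Averaging over the orbits of a reflection reduces comparisons of integrals to pointwise
comparisons on orbits. -/
theorem integral_eq_half_of_measurePreserving {α : Type*} [MeasurableSpace α] {μ : Measure α}
    {T : α → α} (hT : MeasurePreserving T μ μ) {f : α → ℝ} (hf : Integrable f μ) :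
    ∫ x, f x ∂μ = 1 / 2 * ∫ x, (f x + f (T x)) ∂μ := by
  have h1 : Integrable (fun x => f (T x)) μ := hT.integrable_comp_of_integrable hf
  have h2 : ∫ x, f (T x) ∂μ = ∫ x, f x ∂μ := by
    conv_rhs => rw [← hT.map_eq]
    rw [integral_map hT.measurable.aemeasurable]
    rw [hT.map_eq]
    exact hf.aestronglyMeasurable
  rw [integral_add hf h1, h2]
  ring

open Classical in
/-- The polarization (two-point rearrangement) of `u` with respect to the involution `θ`: on each
orbit the larger value is moved to the point closer to the origin. -/
noncomputable def polarize (θ : R3 → R3) (u : R3 → ℝ) (z : R3) : ℝ :=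
  if ‖z‖ ≤ ‖θ z‖ then max (u z) (u (θ z)) else min (u z) (u (θ z))

namespace IsAffineReflection

variable {θ : R3 → R3} {u : R3 → ℝ}

/-- One of `z`, `θ z` is on the origin's side and receives the maximum. A tie in norm occurs only at
a fixed point, where maximum and minimum agree. -/
theorem polarize_apply_cases (hθ : IsAffineReflection θ) (u : R3 → ℝ) (z : R3) :
    (‖z‖ ≤ ‖θ z‖ ∧ polarize θ u z = max (u z) (u (θ z)) ∧
      polarize θ u (θ z) = min (u z) (u (θ z))) ∨
    (‖θ z‖ ≤ ‖θ (θ z)‖ ∧ polarize θ u z = min (u z) (u (θ z)) ∧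
      polarize θ u (θ z) = max (u z) (u (θ z))) := by
  unfold polarize
  rw [hθ.involutive]
  by_cases h : ‖z‖ ≤ ‖θ z‖
  · left
    refine ⟨h, if_pos h, ?_⟩
    by_cases h2 : ‖θ z‖ ≤ ‖z‖
    · have := hθ.eq_of_norm_eq z (le_antisymm h h2)
      simp [this]
    · rw [if_neg h2, min_comm]
  · right
    have h2 := (not_le.1 h).le
    refine ⟨h2, if_neg h, ?_⟩
    rw [if_pos h2, max_comm]

theorem comp_polarize_add (hθ : IsAffineReflection θ) (G : ℝ → ℝ) (z : R3) :
    G (polarize θ u z) + G (polarize θ u (θ z)) = G (u z) + G (u (θ z)) := by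
  rcases hθ.polarize_apply_cases u z with ⟨-, h1, h2⟩ | ⟨-, h1, h2⟩ <;> rw [h1, h2] <;>
    rcases le_total (u z) (u (θ z)) with h | h <;> simp [h, add_comm]

theorem integral_comp_polarize (hθ : IsAffineReflection θ) {G : ℝ → ℝ}
    (h1 : Integrable fun x => G (u x))
    (h2 : Integrable fun x => G (polarize θ u x)) :
    ∫ x, G (polarize θ u x) = ∫ x, G (u x) := by
  rw [integral_eq_half_of_measurePreserving hθ.measurePreserving h1,
    integral_eq_half_of_measurePreserving hθ.measurePreserving h2]
  simp only [hθ.comp_polarize_add]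

/-- Two-point rearrangement inequality: when the pairs are oppositely ordered, the gain is `(a - b)
|p - p'| |q - q'|`; otherwise it is zero. -/
theorem mul_add_mul_le_max_min {a b p p' q q' : ℝ} (h : b ≤ a) :
    a * (p * q + p' * q') + b * (p * q' + p' * q) ≤
      a * (max p p' * max q q' + min p p' * min q q') +
        b * (max p p' * min q q' + min p p' * max q q') := by
  have h' := sub_nonneg.2 h
  rcases le_total p p' with h1 | h1 <;> rcases le_total q q' with h2 | h2 <;>
    simp only [max_eq_left, max_eq_right, min_eq_left, min_eq_right, h1, h2]
  · linarith
  · have := mul_nonneg h' (mul_nonneg (sub_nonneg.2 h1) (sub_nonneg.2 h2))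
    linarith
  · have := mul_nonneg h' (mul_nonneg (sub_nonneg.2 h1) (sub_nonneg.2 h2))
    linarith
  · linarith

theorem norm_sub_left (hθ : IsAffineReflection θ) (z w : R3) : ‖θ z - w‖ = ‖z - θ w‖ := by
  rw [← dist_eq_norm, ← dist_eq_norm, ← hθ.isometry.dist_eq z, hθ.involutive]

theorem norm_sub_both (hθ : IsAffineReflection θ) (z w : R3) : ‖θ z - θ w‖ = ‖z - w‖ := by
  rw [hθ.norm_sub_left, hθ.involutive]

theorem norm_sub_ge (hθ : IsAffineReflection θ) {z w : R3} (h1 : ‖z‖ ≤ ‖θ z‖)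
    (h2 : ‖θ w‖ ≤ ‖θ (θ w)‖) :
    ‖z - θ w‖ ≤ ‖z - w‖ := by
  simpa [hθ.involutive] using hθ.norm_sub_le z (θ w) h1 h2

/-- Only the distances `‖z - w‖` and `‖z - θ w‖` occur among the four pairs, and the shorter one
belongs to points on the same side. The two exclusions are needed because `0⁻¹ = 0` breaks the
monotonicity of the inverse. -/
theorem coulombIntegrand_sum_le (hθ : IsAffineReflection θ) {z w : R3} (h1 : z ≠ w)
    (h2 : z ≠ θ w) :
    (coulombIntegrand u (z, w) + coulombIntegrand u (θ z, w)) +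
      (coulombIntegrand u (z, θ w) + coulombIntegrand u (θ z, θ w)) ≤
    (coulombIntegrand (polarize θ u) (z, w) + coulombIntegrand (polarize θ u) (θ z, w)) +
      (coulombIntegrand (polarize θ u) (z, θ w) +
        coulombIntegrand (polarize θ u) (θ z, θ w)) := by
  have e : ∀ v : R3 → ℝ, (coulombIntegrand v (z, w) + coulombIntegrand v (θ z, w)) +
      (coulombIntegrand v (z, θ w) + coulombIntegrand v (θ z, θ w)) =
      ‖z - w‖⁻¹ * (v z * v w + v (θ z) * v (θ w)) +
        ‖z - θ w‖⁻¹ * (v z * v (θ w) + v (θ z) * v w) := by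
    intro v
    simp only [coulombIntegrand, hθ.norm_sub_both, hθ.norm_sub_left]
    ring
  rw [e, e]
  have p1 : 0 < ‖z - w‖ := norm_pos_iff.2 (sub_ne_zero.2 h1)
  have p2 : 0 < ‖z - θ w‖ := norm_pos_iff.2 (sub_ne_zero.2 h2)
  rcases hθ.polarize_apply_cases u z with ⟨hz, e1, e2⟩ | ⟨hz, e1, e2⟩ <;>
    rcases hθ.polarize_apply_cases u w with ⟨hw, e3, e4⟩ | ⟨hw, e3, e4⟩ <;>
    rw [e1, e2, e3, e4]
  · exact mul_add_mul_le_max_min (inv_anti₀ p1 (hθ.norm_sub_le z w hz hw))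
  · have := mul_add_mul_le_max_min (p := u z) (p' := u (θ z)) (q := u (θ w)) (q' := u w)
      (inv_anti₀ p2 (hθ.norm_sub_ge hz hw))
    rw [max_comm (u (θ w)), min_comm (u (θ w))] at this
    linarith
  · have h3 : ‖z - θ w‖ ≤ ‖z - w‖ := by
      have := hθ.norm_sub_ge hw hz
      rwa [norm_sub_rev, hθ.norm_sub_left, norm_sub_rev w] at this
    have := mul_add_mul_le_max_min (p := u z) (p' := u (θ z)) (q := u (θ w)) (q' := u w)
      (inv_anti₀ p2 h3)
    rw [max_comm (u (θ w)), min_comm (u (θ w))] at this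
    linarith
  · have h3 : ‖z - w‖ ≤ ‖z - θ w‖ := by
      have := hθ.norm_sub_le (θ z) (θ w) hz hw
      rwa [hθ.norm_sub_both, hθ.involutive, hθ.norm_sub_left] at this
    have := mul_add_mul_le_max_min (p := u z) (p' := u (θ z)) (q := u w) (q' := u (θ w))
      (inv_anti₀ p1 h3)
    linarith

theorem ae_snd_ne_comp_fst {f : R3 → R3} (hf : Measurable f) :
    ∀ᵐ p : R3 × R3, p.2 ≠ f p.1 := by
  have hm : MeasurableSet {p : R3 × R3 | p.2 = f p.1} :=
    measurableSet_eq_fun measurable_snd (hf.comp measurable_fst)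
  rw [ae_iff]
  simp only [not_not]
  rw [Measure.volume_eq_prod, Measure.measure_prod_null hm]
  refine Eventually.of_forall fun x => ?_
  have : Prod.mk x ⁻¹' {p : R3 × R3 | p.2 = f p.1} = {f x} := by ext; simp
  simp [this]

theorem coulomb_le_coulomb_polarize (hθ : IsAffineReflection θ)
    (h1 : Integrable (coulombIntegrand u))
    (h2 : Integrable (coulombIntegrand (polarize θ u))) :
    coulomb u ≤ coulomb (polarize θ u) := by
  have m1 : MeasurePreserving (Prod.map θ id : R3 × R3 → R3 × R3) volume volume :=
    hθ.measurePreserving.prod (MeasurePreserving.id _)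
  have m2 : MeasurePreserving (Prod.map id θ : R3 × R3 → R3 × R3) volume volume :=
    (MeasurePreserving.id _).prod hθ.measurePreserving
  have i1 : ∀ {v : R3 → ℝ}, Integrable (coulombIntegrand v) →
      Integrable (fun p : R3 × R3 => coulombIntegrand v p +
        coulombIntegrand v (Prod.map θ id p)) :=
    fun hv => hv.add (m1.integrable_comp_of_integrable hv)
  have key : ∀ {v : R3 → ℝ}, Integrable (coulombIntegrand v) → coulomb v = 1 / 2 * (1 / 2 *
      ∫ p : R3 × R3, (coulombIntegrand v (p.1, p.2) + coulombIntegrand v (θ p.1, p.2)) +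
      (coulombIntegrand v (p.1, θ p.2) + coulombIntegrand v (θ p.1, θ p.2))) := by
    intro v hv
    unfold coulomb
    rw [integral_eq_half_of_measurePreserving m1 hv,
      integral_eq_half_of_measurePreserving m2 (i1 hv)]
    rfl
  have i2 : ∀ {v : R3 → ℝ}, Integrable (coulombIntegrand v) → Integrable (fun p : R3 × R3 =>
      (coulombIntegrand v (p.1, p.2) + coulombIntegrand v (θ p.1, p.2)) +
      (coulombIntegrand v (p.1, θ p.2) + coulombIntegrand v (θ p.1, θ p.2))) :=
    fun hv => (i1 hv).add (m2.integrable_comp_of_integrable (i1 hv))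
  rw [key h1, key h2]
  gcongr 1 / 2 * (1 / 2 * ?_)
  refine integral_mono_ae (i2 h1) (i2 h2) ?_
  filter_upwards [ae_snd_ne_comp_fst measurable_id,
    ae_snd_ne_comp_fst hθ.measurePreserving.measurable] with p hp1 hp2
  exact hθ.coulombIntegrand_sum_le (Ne.symm hp1) fun h => hp2 (by rw [h, hθ.involutive])

theorem polarize_nonneg (h0 : ∀ x, 0 ≤ u x) (z : R3) : 0 ≤ polarize θ u z := by
  unfold polarize
  split_ifs
  · exact le_max_of_le_left (h0 _)
  · exact le_min (h0 _) (h0 _)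

theorem polarize_eq_zero (h0 : ∀ x, 0 ≤ u x) {R : ℝ} (hR : ∀ x, R < ‖x‖ → u x = 0) (z : R3)
    (hz : R < ‖z‖) : polarize θ u z = 0 := by
  unfold polarize
  split_ifs with h
  · rw [hR z hz, hR _ (hz.trans_le h), max_self]
  · rw [hR z hz, min_eq_left (h0 _)]

/-- For points on the same side, maxima are compared with maxima or minima with minima. For points
on opposite sides, `x` is no farther from `θ y` than from `y`, so all four differences of values are
controlled. -/
theorem abs_polarize_sub_le (hθ : IsAffineReflection θ) {ε : ℝ} {x y : R3}
    (hu : ∀ a b : R3, ‖a - b‖ ≤ ‖x - y‖ → |u a - u b| ≤ ε) :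
    |polarize θ u x - polarize θ u y| ≤ ε := by
  have h1 := hu x y le_rfl
  have h2 := hu (θ x) (θ y) (hθ.norm_sub_both x y).le
  have h4 : ‖x - θ y‖ ≤ ‖x - y‖ → |u x - u (θ y)| ≤ ε ∧ |u (θ x) - u y| ≤ ε :=
    fun h => ⟨hu _ _ h, hu _ _ ((hθ.norm_sub_left x y).le.trans h)⟩
  rcases hθ.polarize_apply_cases u x with ⟨hz, e1, -⟩ | ⟨hz, e1, -⟩ <;>
    rcases hθ.polarize_apply_cases u y with ⟨hw, e3, -⟩ | ⟨hw, e3, -⟩ <;> rw [e1, e3]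
  · exact (abs_max_sub_max_le_max _ _ _ _).trans (max_le h1 h2)
  · obtain ⟨h5, h6⟩ := h4 (hθ.norm_sub_ge hz hw)
    rw [abs_le] at *
    rcases max_cases (u x) (u (θ x)) with ⟨h, -⟩ | ⟨h, -⟩ <;>
      rcases min_cases (u y) (u (θ y)) with ⟨h', -⟩ | ⟨h', -⟩ <;> rw [h, h'] <;> assumption
  · have h7 : ‖x - θ y‖ ≤ ‖x - y‖ := by
      have := hθ.norm_sub_ge hw hz
      rwa [norm_sub_rev, hθ.norm_sub_left, norm_sub_rev y] at this
    obtain ⟨h5, h6⟩ := h4 h7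
    rw [abs_le] at *
    rcases min_cases (u x) (u (θ x)) with ⟨h, -⟩ | ⟨h, -⟩ <;>
      rcases max_cases (u y) (u (θ y)) with ⟨h', -⟩ | ⟨h', -⟩ <;> rw [h, h'] <;> assumption
  · exact (abs_min_sub_min_le_max _ _ _ _).trans (max_le h1 h2)

/-- Polarization strictly decreases the second moment unless it leaves `u` ordered. -/
theorem le_of_moment_le (hθ : IsAffineReflection θ) (hc : Continuous u)
    (hc' : Continuous (polarize θ u))
    (h1 : Integrable fun x => ‖x‖ ^ 2 * u x) (h2 : Integrable fun x => ‖x‖ ^ 2 * polarize θ u x)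
    (hle : ∫ x, ‖x‖ ^ 2 * u x ≤ ∫ x, ‖x‖ ^ 2 * polarize θ u x) {z : R3}
    (hz : ‖z‖ < ‖θ z‖) : u (θ z) ≤ u z := by
  have m := hθ.measurePreserving
  have i1 := h1.add (m.integrable_comp_of_integrable h1)
  have i2 := h2.add (m.integrable_comp_of_integrable h2)
  have e : ∀ x, polarize θ u (θ x) = u x + u (θ x) - polarize θ u x := fun x => by
    have := hθ.comp_polarize_add (u := u) id x
    simp only [id] at this
    linarith
  -- The loss of second moment on one orbit. The two factors on the right never have opposite signs,
  -- as the larger value moves inward.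
  have hd : ∀ x, (‖x‖ ^ 2 * u x + ‖θ x‖ ^ 2 * u (θ x)) -
      (‖x‖ ^ 2 * polarize θ u x + ‖θ x‖ ^ 2 * polarize θ u (θ x)) =
      (‖θ x‖ ^ 2 - ‖x‖ ^ 2) * (polarize θ u x - u x) := by
    intro x; rw [e]; ring
  have hpos : ∀ x, 0 ≤ (‖θ x‖ ^ 2 - ‖x‖ ^ 2) * (polarize θ u x - u x) := by
    intro x
    unfold polarize
    split_ifs with h
    · exact mul_nonneg (sub_nonneg.2 (by gcongr)) (sub_nonneg.2 (le_max_left _ _))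
    · have := (not_le.1 h).le
      exact mul_nonneg_of_nonpos_of_nonpos (sub_nonpos.2 (by gcongr))
        (sub_nonpos.2 (min_le_left _ _))
  have hint : Integrable fun x => (‖θ x‖ ^ 2 - ‖x‖ ^ 2) * (polarize θ u x - u x) := by
    refine (i1.sub i2).congr (Eventually.of_forall fun x => ?_)
    exact hd x
  have hz0 : ∫ x, (‖θ x‖ ^ 2 - ‖x‖ ^ 2) * (polarize θ u x - u x) = 0 := by
    refine le_antisymm ?_ (integral_nonneg hpos)
    have e3 := integral_eq_half_of_measurePreserving m h1
    have e4 := integral_eq_half_of_measurePreserving m h2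
    have e5 := integral_sub i1 i2
    simp only [Pi.add_apply, Function.comp, hd] at e5
    linarith
  -- Continuity upgrades vanishing almost everywhere to vanishing at the given point `z`.
  have hcont : Continuous fun x => (‖θ x‖ ^ 2 - ‖x‖ ^ 2) * (polarize θ u x - u x) := by
    have := hθ.isometry.continuous
    fun_prop
  have h0 : (fun x => (‖θ x‖ ^ 2 - ‖x‖ ^ 2) * (polarize θ u x - u x)) = fun _ => 0 :=
    (Continuous.ae_eq_iff_eq volume hcont continuous_const).1
      ((integral_eq_zero_iff_of_nonneg hpos hint).1 hz0)
  have h3 := congrFun h0 z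
  have h4 : 0 < ‖θ z‖ ^ 2 - ‖z‖ ^ 2 := sub_pos.2 (by gcongr)
  have h5 : polarize θ u z = u z := by
    have := (mul_eq_zero.1 h3).resolve_left h4.ne'
    linarith
  rw [← h5]
  unfold polarize
  rw [if_pos hz.le]
  exact le_max_right _ _

end IsAffineReflection

/-! ### A compact class stable under polarization -/

/-- Nonnegative functions bounded by `M`, supported in the ball of radius `R`, with modulus of
continuity prescribed by `δ`. -/
structure IsTestFun (δ : ℝ → ℝ) (M R : ℝ) (u : R3 → ℝ) : Prop where
  nonneg : ∀ x, 0 ≤ u x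
  le_bound : ∀ x, u x ≤ M
  eq_zero : ∀ x, R < ‖x‖ → u x = 0
  modulus : ∀ ε > 0, ∀ x y, ‖x - y‖ ≤ δ ε → |u x - u y| ≤ ε

/-- The constant `M` on the ball of radius `R`. -/
noncomputable def ballFun (M R : ℝ) : R3 → ℝ := (Metric.closedBall 0 R).indicator fun _ => M

theorem measurable_ballFun (M R : ℝ) : Measurable (ballFun M R) :=
  measurable_const.indicator measurableSet_closedBall

theorem ballFun_nonneg {M : ℝ} (hM : 0 ≤ M) (R : ℝ) (x : R3) : 0 ≤ ballFun M R x :=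
  indicator_nonneg (fun _ _ => hM) x

theorem ballFun_of_le {M R : ℝ} {x : R3} (hx : ‖x‖ ≤ R) : ballFun M R x = M :=
  indicator_of_mem (by simpa using hx) _

theorem ballFun_of_lt {M R : ℝ} {x : R3} (hx : R < ‖x‖) : ballFun M R x = 0 :=
  indicator_of_notMem (by simpa using hx) _

theorem integrable_ballFun (M R : ℝ) : Integrable (ballFun M R) := by
  unfold ballFun
  rw [integrable_indicator_iff measurableSet_closedBall]
  exact integrableOn_const (hs := measure_closedBall_lt_top.ne)

theorem ballFun_rpow (M R : ℝ) {a : ℝ} (ha : a ≠ 0) (x : R3) :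
    ballFun M R x ^ a = ballFun (M ^ a) R x := by
  rcases le_or_gt ‖x‖ R with h | h
  · rw [ballFun_of_le h, ballFun_of_le h]
  · rw [ballFun_of_lt h, ballFun_of_lt h, Real.zero_rpow ha]

theorem integrable_ballFun_rpow (M R : ℝ) {a : ℝ} (ha : a ≠ 0) :
    Integrable fun x => ballFun M R x ^ a := by
  simp only [ballFun_rpow M R ha]
  exact integrable_ballFun _ _

theorem integrable_coulombIntegrand_ballFun {M : ℝ} (hM : 0 ≤ M) (R : ℝ) :
    Integrable (coulombIntegrand (ballFun M R)) :=
  integrable_coulombIntegrand' (measurable_ballFun M R) (ballFun_nonneg hM R)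
    (integrable_ballFun M R) (integrable_ballFun_rpow M R (by norm_num))

theorem tendsto_integral_rpow {u : ℕ → R3 → ℝ} {v B : R3 → ℝ} {a : ℝ} (ha : 0 < a)
    (hu : ∀ n, Measurable (u n)) (h0 : ∀ n x, 0 ≤ u n x) (hB : ∀ n x, u n x ≤ B x)
    (hF : Integrable fun x => B x ^ a)
    (hlim : ∀ᵐ x, Tendsto (fun n => u n x) atTop (𝓝 (v x))) :
    Tendsto (fun n => ∫ x, u n x ^ a) atTop (𝓝 (∫ x, v x ^ a)) := by
  refine tendsto_integral_of_dominated_convergence (fun x => B x ^ a)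
    (fun n => ((hu n).pow_const a).aestronglyMeasurable) hF
    (fun n => Eventually.of_forall fun x => ?_) ?_
  · rw [Real.norm_of_nonneg (Real.rpow_nonneg (h0 n x) _)]
    exact Real.rpow_le_rpow (h0 n x) (hB n x) ha.le
  · filter_upwards [hlim] with x hx
    exact hx.rpow_const (Or.inr ha.le)

namespace IsTestFun

variable {δ : ℝ → ℝ} {M R : ℝ} {u : R3 → ℝ}

theorem bound_nonneg (h : IsTestFun δ M R u) : 0 ≤ M := (h.nonneg 0).trans (h.le_bound 0)

theorem continuous (h : IsTestFun δ M R u) (hδ : ∀ ε > 0, 0 < δ ε) : Continuous u := by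
  rw [Metric.continuous_iff]
  intro x ε hε
  refine ⟨δ (ε / 2), hδ _ (by positivity), fun y hy => ?_⟩
  rw [Real.dist_eq]
  rw [dist_eq_norm] at hy
  have := h.modulus (ε / 2) (by positivity) y x hy.le
  linarith

theorem le_ballFun (h : IsTestFun δ M R u) (x : R3) : u x ≤ ballFun M R x := by
  rcases le_or_gt ‖x‖ R with hx | hx
  · rw [ballFun_of_le hx]; exact h.le_bound x
  · rw [ballFun_of_lt hx, h.eq_zero x hx]

theorem integrable (h : IsTestFun δ M R u) (hδ : ∀ ε > 0, 0 < δ ε) : Integrable u :=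
  (integrable_ballFun M R).mono' (h.continuous hδ).aestronglyMeasurable
    (Eventually.of_forall fun x => by
      rw [Real.norm_of_nonneg (h.nonneg x)]; exact h.le_ballFun x)

theorem integrable_rpow (h : IsTestFun δ M R u) (hδ : ∀ ε > 0, 0 < δ ε) :
    Integrable fun x => u x ^ (5 / 3 : ℝ) :=
  (integrable_ballFun_rpow M R (a := 5 / 3) (by norm_num)).mono'
    ((h.continuous hδ).measurable.pow_const _).aestronglyMeasurable
    (Eventually.of_forall fun x => by
      rw [Real.norm_of_nonneg (Real.rpow_nonneg (h.nonneg x) _)]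
      exact Real.rpow_le_rpow (h.nonneg x) (h.le_ballFun x) (by norm_num))

theorem integrable_coulombIntegrand (h : IsTestFun δ M R u) (hδ : ∀ ε > 0, 0 < δ ε) :
    Integrable (coulombIntegrand u) :=
  integrable_coulombIntegrand' (h.continuous hδ).measurable h.nonneg (h.integrable hδ)
    (h.integrable_rpow hδ)

theorem moment_le (h : IsTestFun δ M R u) (x : R3) :
    ‖x‖ ^ 2 * u x ≤ R ^ 2 * ballFun M R x := by
  rcases le_or_gt ‖x‖ R with hx | hx
  · have := h.nonneg x
    have := h.bound_nonneg
    rw [ballFun_of_le hx]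
    gcongr
    exact h.le_bound x
  · rw [ballFun_of_lt hx, h.eq_zero x hx]; simp

theorem integrable_moment (h : IsTestFun δ M R u) (hδ : ∀ ε > 0, 0 < δ ε) :
    Integrable fun x => ‖x‖ ^ 2 * u x := by
  have := h.continuous hδ
  refine ((integrable_ballFun M R).const_mul (R ^ 2)).mono'
    (by fun_prop : Continuous fun x => ‖x‖ ^ 2 * u x).aestronglyMeasurable
    (Eventually.of_forall fun x => ?_)
  rw [Real.norm_of_nonneg (mul_nonneg (by positivity) (h.nonneg x))]
  exact h.moment_le x

theorem polarize (h : IsTestFun δ M R u) {θ : R3 → R3} (hθ : IsAffineReflection θ) :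
    IsTestFun δ M R (polarize θ u) where
  nonneg := IsAffineReflection.polarize_nonneg h.nonneg
  le_bound x := by
    unfold NeutronStar.polarize
    split_ifs
    · exact max_le (h.le_bound _) (h.le_bound _)
    · exact (min_le_left _ _).trans (h.le_bound _)
  eq_zero := IsAffineReflection.polarize_eq_zero h.nonneg h.eq_zero
  modulus ε hε x y hxy :=
    hθ.abs_polarize_sub_le fun a b hab => h.modulus ε hε a b (hab.trans hxy)

/-- Arzelà–Ascoli: the defining conditions are closed under pointwise limits, values lie in `[0,
M]`, and the common modulus gives equicontinuity. -/
theorem exists_tendsto_subseq (hδ : ∀ ε > 0, 0 < δ ε) {v : ℕ → R3 → ℝ}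
    (h : ∀ n, IsTestFun δ M R (v n)) :
    ∃ w, IsTestFun δ M R w ∧ ∃ φ : ℕ → ℕ, StrictMono φ ∧
      ∀ x, Tendsto (fun n => v (φ n) x) atTop (𝓝 (w x)) := by
  let S : Set C(R3, ℝ) := {f | IsTestFun δ M R f}
  have himg : ContinuousMap.toFun '' S = {f | IsTestFun δ M R f} := by
    ext f
    constructor
    · rintro ⟨g, hg, rfl⟩; exact hg
    · intro hf; exact ⟨⟨f, IsTestFun.continuous hf hδ⟩, hf, rfl⟩
  have hS : IsCompact S := by
    apply ArzelaAscoli.isCompact_of_equicontinuous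
    · rw [himg]
      have hcl : IsClosed {f : R3 → ℝ | IsTestFun δ M R f} := by
        have : {f : R3 → ℝ | IsTestFun δ M R f} =
            (⋂ x, {f | 0 ≤ f x}) ∩ ((⋂ x, {f | f x ≤ M}) ∩ ((⋂ x, ⋂ (_ : R < ‖x‖), {f | f x = 0}) ∩
              (⋂ ε, ⋂ (_ : ε > 0), ⋂ x, ⋂ y, ⋂ (_ : ‖x - y‖ ≤ δ ε),
                {f | |f x - f y| ≤ ε}))) := by
          ext f
          simp only [mem_ofPred_eq, mem_inter_iff, mem_iInter]
          exact ⟨fun h => ⟨h.1, h.2, h.3, h.4⟩, fun h => ⟨h.1, h.2.1, h.2.2.1, h.2.2.2⟩⟩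
        rw [this]
        refine IsClosed.inter (isClosed_iInter fun x => ?_) (IsClosed.inter
          (isClosed_iInter fun x => ?_) (IsClosed.inter (isClosed_iInter fun x =>
          isClosed_iInter fun _ => ?_) (isClosed_iInter fun ε => isClosed_iInter fun _ =>
          isClosed_iInter fun x => isClosed_iInter fun y => isClosed_iInter fun _ => ?_)))
        · exact isClosed_le continuous_const (continuous_apply x)
        · exact isClosed_le (continuous_apply x) continuous_const
        · exact isClosed_eq (continuous_apply x) continuous_const
        · exact isClosed_le ((continuous_apply x).sub (continuous_apply y)).abs continuous_const
      refine (isCompact_univ_pi fun _ : R3 => isCompact_Icc (a := (0 : ℝ)) (b := M)).of_isClosed_subset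
        hcl fun f hf x _ => ⟨hf.nonneg x, hf.le_bound x⟩
    · refine fun x => Metric.equicontinuousAt_iff.2 fun ε hε => ?_
      refine ⟨δ (ε / 2), hδ _ (by positivity), fun y hy f => ?_⟩
      rw [dist_eq_norm, norm_sub_rev] at hy
      have := f.2.modulus (ε / 2) (by positivity) x y hy.le
      rw [Real.dist_eq]
      exact this.trans_lt (by linarith)
  obtain ⟨w, hw, φ, hφ, hlim⟩ := hS.tendsto_subseq
    (x := fun n => (⟨v n, (h n).continuous hδ⟩ : C(R3, ℝ))) (fun n => h n)
  exact ⟨w, hw, φ, hφ, fun x =>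
    ((continuous_eval_const x).tendsto w).comp hlim⟩

end IsTestFun

theorem exists_isTestFun {f : R3 → ℝ} (hf : Continuous f) (hs : HasCompactSupport f)
    (h0 : ∀ x, 0 ≤ f x) : ∃ δ M R, (∀ ε > 0, 0 < δ ε) ∧ IsTestFun δ M R f := by
  have huc := hs.uniformContinuous_of_continuous hf
  rw [Metric.uniformContinuous_iff] at huc
  -- Stated for every real `ε`, with the dummy value 1 when `ε ≤ 0`, so that `choose` returns a
  -- function on `ℝ`; halving `d` allows the non-strict inequality.
  have huc' : ∀ ε : ℝ, ∃ d > 0, ε > 0 → ∀ x y : R3, ‖x - y‖ ≤ d → |f x - f y| ≤ ε := by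
    intro ε
    by_cases hε : ε > 0
    · obtain ⟨d, hd, h⟩ := huc ε hε
      refine ⟨d / 2, by positivity, fun _ x y hxy => ?_⟩
      have := h (a := x) (b := y) (by rw [dist_eq_norm]; linarith)
      rw [Real.dist_eq] at this
      exact this.le
    · exact ⟨1, one_pos, fun h => absurd h hε⟩
  choose δ hδ hm using huc'
  obtain ⟨M, hM⟩ := hf.bounded_above_of_compact_support hs
  obtain ⟨R, hR⟩ := hs.isCompact.isBounded.subset_closedBall (0 : R3)
  refine ⟨δ, M, R, fun ε _ => hδ ε, h0, fun x => (le_abs_self _).trans (hM x), fun x hx => ?_,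
    fun ε hε => hm ε hε⟩
  by_contra h
  have := hR (subset_tsupport f h)
  rw [mem_closedBall_zero_iff] at this
  linarith

/-- Every continuous compactly supported density may be replaced by a radially decreasing one
without changing its mass and kinetic energy, and without decreasing the interaction energy. -/
theorem exists_radially_decreasing {f : R3 → ℝ} (hf : Continuous f) (hs : HasCompactSupport f)
    (h0 : ∀ x, 0 ≤ f x) : ∃ u : R3 → ℝ, Continuous u ∧ HasCompactSupport u ∧ (∀ x, 0 ≤ u x) ∧
      ∫ x, u x = ∫ x, f x ∧ ∫ x, u x ^ (5 / 3 : ℝ) = ∫ x, f x ^ (5 / 3 : ℝ) ∧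
      coulomb f ≤ coulomb u ∧ ∀ x y, ‖x‖ < ‖y‖ → u y ≤ u x := by
  obtain ⟨δ, M, R, hδ, hfT⟩ := exists_isTestFun hf hs h0
  let S : Set (R3 → ℝ) := {u | IsTestFun δ M R u ∧ ∫ x, u x = ∫ x, f x ∧
    ∫ x, u x ^ (5 / 3 : ℝ) = ∫ x, f x ^ (5 / 3 : ℝ) ∧ coulomb f ≤ coulomb u}
  -- The second moment detects any polarization that changes `u`; its minimizer over `S` is the
  -- rearranged function.
  let V : (R3 → ℝ) → ℝ := fun u => ∫ x, ‖x‖ ^ 2 * u x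
  have hne : (V '' S).Nonempty := ⟨V f, f, ⟨hfT, rfl, rfl, le_rfl⟩, rfl⟩
  have hbdd : BddBelow (V '' S) := by
    refine ⟨0, ?_⟩
    rintro _ ⟨u, hu, rfl⟩
    exact integral_nonneg fun x => mul_nonneg (by positivity) (hu.1.nonneg x)
  obtain ⟨a, -, ha, haS⟩ := exists_seq_tendsto_sInf hne hbdd
  choose v hvS hva using haS
  obtain ⟨w, hw, φ, hφ, hlim⟩ := IsTestFun.exists_tendsto_subseq hδ fun n => (hvS n).1
  have hae : ∀ᵐ x, Tendsto (fun n => v (φ n) x) atTop (𝓝 (w x)) := Eventually.of_forall hlim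
  have hmeas : ∀ n, Measurable (v (φ n)) := fun n => ((hvS _).1.continuous hδ).measurable
  have hnn : ∀ n x, 0 ≤ v (φ n) x := fun n => (hvS _).1.nonneg
  have hle : ∀ n x, v (φ n) x ≤ ballFun M R x := fun n => (hvS _).1.le_ballFun
  have hMnn := hfT.bound_nonneg
  have hwS : w ∈ S := by
    refine ⟨hw, ?_, ?_, ?_⟩
    · have h := tendsto_integral_rpow one_pos hmeas hnn hle
        (integrable_ballFun_rpow M R one_ne_zero) hae
      simp only [Real.rpow_one, (hvS _).2.1] at h
      exact tendsto_nhds_unique h tendsto_const_nhds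
    · have h := tendsto_integral_rpow (a := 5 / 3) (by norm_num) hmeas hnn hle
        (integrable_ballFun_rpow M R (by norm_num)) hae
      simp only [(hvS _).2.2.1] at h
      exact tendsto_nhds_unique h tendsto_const_nhds
    · have h := tendsto_coulomb hmeas hnn (fun n => Eventually.of_forall (hle n))
        (integrable_coulombIntegrand_ballFun hMnn R) hae
      exact ge_of_tendsto' h fun n => (hvS _).2.2.2
  have hVw : V w = sInf (V '' S) := by
    refine tendsto_nhds_unique (f := fun n => V (v (φ n))) (l := atTop) ?_ ?_
    · refine tendsto_integral_of_dominated_convergence (fun x => R ^ 2 * ballFun M R x)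
        (fun n => ((hvS _).1.integrable_moment hδ).aestronglyMeasurable)
        ((integrable_ballFun M R).const_mul _) (fun n => Eventually.of_forall fun x => ?_)
        (Eventually.of_forall fun x => (hlim x).const_mul _)
      rw [Real.norm_of_nonneg (mul_nonneg (by positivity) (hnn n x))]
      exact (hvS _).1.moment_le x
    · simp only [hva]
      exact ha.comp hφ.tendsto_atTop
  refine ⟨w, hw.continuous hδ, ?_, hw.nonneg, hwS.2.1, hwS.2.2.1, hwS.2.2.2, fun x y hxy => ?_⟩
  · refine HasCompactSupport.intro (isCompact_closedBall (0 : R3) R) fun x hx => hw.eq_zero x ?_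
    simpa using hx
  -- Polarizing `w` by the reflection that takes `x` to `y` stays in `S`, so it cannot lower the
  -- moment, and `w` is already ordered at this pair.
  · obtain ⟨θ, hθ, rfl⟩ := exists_isAffineReflection hxy
    have hp := hw.polarize hθ
    have hpS : polarize θ w ∈ S := by
      refine ⟨hp, ?_, ?_, ?_⟩
      · rw [← hwS.2.1]
        exact hθ.integral_comp_polarize (G := id) (hw.integrable hδ) (hp.integrable hδ)
      · rw [← hwS.2.2.1]
        exact hθ.integral_comp_polarize (G := fun t => t ^ (5 / 3 : ℝ)) (hw.integrable_rpow hδ)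
          (hp.integrable_rpow hδ)
      · exact hwS.2.2.2.trans (hθ.coulomb_le_coulomb_polarize
          (hw.integrable_coulombIntegrand hδ) (hp.integrable_coulombIntegrand hδ))
    exact hθ.le_of_moment_le (hw.continuous hδ) (hp.continuous hδ) (hw.integrable_moment hδ)
      (hp.integrable_moment hδ) (hVw.le.trans (csInf_le hbdd ⟨_, hpS, rfl⟩)) hxy

/-! ### Reduction to radially decreasing densities -/

/-- The energy `c ∫ u^(5/3) - k ∬ u(x) u(y) / |x - y|`. -/
noncomputable def functional (c k : ℝ) (u : R3 → ℝ) : ℝ :=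
  c * (∫ x, u x ^ (5 / 3 : ℝ)) - k * coulomb u

/-- Everywhere nonnegative measurable densities in `L¹ ∩ L^{5/3}` of mass at most `N`. -/
structure IsSubDensity (N : ℝ) (u : R3 → ℝ) : Prop where
  measurable : Measurable u
  nonneg : ∀ x, 0 ≤ u x
  integrable : Integrable u
  integrable_rpow : Integrable fun x => u x ^ (5 / 3 : ℝ)
  mass_le : ∫ x, u x ≤ N

theorem IsSubDensity.mass_nonneg {N : ℝ} {u : R3 → ℝ} (h : IsSubDensity N u) :
    0 ≤ ∫ x, u x := integral_nonneg h.nonneg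

theorem IsSubDensity.of_continuous {N : ℝ} {u : R3 → ℝ} (hu : Continuous u)
    (hs : HasCompactSupport u) (h0 : ∀ x, 0 ≤ u x) (hN : ∫ x, u x ≤ N) : IsSubDensity N u where
  measurable := hu.measurable
  nonneg := h0
  integrable := hu.integrable_of_hasCompactSupport hs
  integrable_rpow := (hu.rpow_const fun _ => Or.inr (by norm_num)).integrable_of_hasCompactSupport
    (hs.comp_left (g := fun t => t ^ (5 / 3 : ℝ)) (Real.zero_rpow (by norm_num)))
  mass_le := hN

theorem tendsto_functional (c k : ℝ) {u : ℕ → R3 → ℝ} {v B : R3 → ℝ}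
    (hu : ∀ n, Measurable (u n)) (h0 : ∀ n x, 0 ≤ u n x) (hB : ∀ n x, u n x ≤ B x)
    (hBm : Measurable B) (hBi : Integrable B) (hBr : Integrable fun x => B x ^ (5 / 3 : ℝ))
    (hlim : ∀ᵐ x, Tendsto (fun n => u n x) atTop (𝓝 (v x))) :
    Tendsto (fun n => functional c k (u n)) atTop (𝓝 (functional c k v)) :=
  ((tendsto_integral_rpow (by norm_num) hu h0 hB hBr hlim).const_mul c).sub
    ((tendsto_coulomb hu h0 (fun n => Eventually.of_forall (hB n)) (integrable_coulombIntegrand' hBm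
      (fun x => (h0 0 x).trans (hB 0 x)) hBi hBr) hlim).const_mul k)

theorem tendsto_min_ballFun (t : ℝ) (x : R3) :
    Tendsto (fun n : ℕ => min t (ballFun n n x)) atTop (𝓝 t) := by
  obtain ⟨m, hm⟩ := exists_nat_ge (max t ‖x‖)
  refine tendsto_const_nhds.congr' ?_
  filter_upwards [eventually_ge_atTop m] with n hn
  have hn' : (m : ℝ) ≤ n := by exact_mod_cast hn
  rw [ballFun_of_le (((le_max_right _ _).trans hm).trans hn'),
    min_eq_left (((le_max_left _ _).trans hm).trans hn')]

/-- Mollification keeps the mass and the bound `M` and enlarges the support by at most 1, which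
supplies a single dominating function. -/
theorem exists_continuous_approx {f : R3 → ℝ} {M R : ℝ} (hM0 : 0 ≤ M) (hf : Measurable f)
    (h0 : ∀ x, 0 ≤ f x) (hM : ∀ x, f x ≤ ballFun M R x) :
    ∃ g : ℕ → R3 → ℝ, (∀ n, Continuous (g n)) ∧ (∀ n x, 0 ≤ g n x) ∧
      (∀ n x, g n x ≤ ballFun M (R + 1) x) ∧ (∀ n, ∫ x, g n x = ∫ x, f x) ∧
      ∀ᵐ x, Tendsto (fun n => g n x) atTop (𝓝 (f x)) := by
  have hfi : Integrable f := (integrable_ballFun M R).mono' hf.aestronglyMeasurable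
    (Eventually.of_forall fun x => by rw [Real.norm_of_nonneg (h0 x)]; exact hM x)
  -- Outer radius exactly twice the inner one: a.e. convergence of the convolutions needs a bounded
  -- ratio of radii.
  let φ : ℕ → ContDiffBump (0 : R3) := fun n =>
    ⟨1 / (2 * (n + 1)), 1 / (n + 1), by positivity, by
      apply one_div_lt_one_div_of_lt <;> [positivity; linarith [(by positivity : (0:ℝ) < n + 1)]]⟩
  have hφ1 : ∀ n, (φ n).rOut ≤ 1 := fun n => by
    simp only [φ]
    rw [div_le_one (by positivity)]
    linarith [(by positivity : (0 : ℝ) ≤ n)]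
  let g : ℕ → R3 → ℝ := fun n =>
    ((φ n).normed volume ⋆[ContinuousLinearMap.lsmul ℝ ℝ, volume] f)
  have hg : ∀ n x, g n x = ∫ t, (φ n).normed volume t * f (x - t) := fun n x => rfl
  have hgi : ∀ n x, Integrable fun t => (φ n).normed volume t * f (x - t) := by
    intro n x
    refine ((φ n).integrable_normed.mul_const M).mono'
      (((φ n).continuous_normed.measurable.mul
        (hf.comp (measurable_const.sub measurable_id))).aestronglyMeasurable)
      (Eventually.of_forall fun t => ?_)
    rw [Real.norm_of_nonneg (mul_nonneg ((φ n).nonneg_normed _) (h0 _))]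
    refine mul_le_mul_of_nonneg_left ((hM _).trans ?_) ((φ n).nonneg_normed _)
    exact indicator_le_self' (fun _ _ => hM0) _
  have hgnn : ∀ n x, 0 ≤ g n x := fun n x =>
    integral_nonneg fun t => mul_nonneg ((φ n).nonneg_normed _) (h0 _)
  refine ⟨g, fun n => ?_, hgnn, fun n x => ?_, fun n => ?_, ?_⟩
  · exact (φ n).hasCompactSupport_normed.continuous_convolution_left _ (φ n).continuous_normed
      hfi.locallyIntegrable
  · rcases le_or_gt ‖x‖ (R + 1) with hx | hx
    · rw [ballFun_of_le hx, hg]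
      calc ∫ t, (φ n).normed volume t * f (x - t) ≤ ∫ t, (φ n).normed volume t * M := by
            refine integral_mono (hgi n x) ((φ n).integrable_normed.mul_const M) fun t => ?_
            refine mul_le_mul_of_nonneg_left ((hM _).trans ?_) ((φ n).nonneg_normed _)
            exact indicator_le_self' (fun _ _ => hM0) _
        _ = M := by rw [integral_mul_const, (φ n).integral_normed, one_mul]
    · rw [ballFun_of_lt hx, hg]
      refine (integral_eq_zero_of_ae (Eventually.of_forall fun t => ?_)).le
      by_cases ht : t ∈ Function.support ((φ n).normed volume)
      · rw [(φ n).support_normed_eq, mem_ball_zero_iff] at ht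
        have h1 : R < ‖x - t‖ := by
          have := norm_sub_norm_le x t
          linarith [hφ1 n]
        have h2 : f (x - t) = 0 := le_antisymm ((hM _).trans_eq (ballFun_of_lt h1)) (h0 _)
        simp [h2]
      · simp [Function.notMem_support.1 ht]
  · have := integral_convolution (ContinuousLinearMap.lsmul ℝ ℝ) (μ := volume) (ν := volume)
      ((φ n).integrable_normed (μ := volume)) hfi
    refine this.trans ?_
    rw [(φ n).integral_normed]
    simp
  · refine ContDiffBump.ae_convolution_tendsto_right_of_locallyIntegrable (K := 2) ?_ ?_
      hfi.locallyIntegrable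
    · exact tendsto_one_div_add_atTop_nhds_zero_nat
    · refine Eventually.of_forall fun n => ?_
      simp only [φ]
      apply le_of_eq
      field_simp

/-- Points of equal norm are reached by pushing `y` outward to `t • y` and letting `t` decrease to
1. The non-strict form contains radial symmetry. -/
theorem radially_decreasing_of_lt {u : R3 → ℝ} (hu : Continuous u)
    (h : ∀ x y, ‖x‖ < ‖y‖ → u y ≤ u x) {x y : R3} (hxy : ‖x‖ ≤ ‖y‖) : u y ≤ u x := by
  rcases eq_or_ne y 0 with rfl | hy
  · have : x = 0 := by simpa using hxy
    rw [this]
  · have hc : Tendsto (fun t : ℝ => u (t • y)) (𝓝[>] 1) (𝓝 (u ((1 : ℝ) • y))) :=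
      ((by fun_prop : Continuous fun t : ℝ => u (t • y)).tendsto 1).mono_left
        nhdsWithin_le_nhds
    rw [one_smul] at hc
    refine le_of_tendsto hc ?_
    filter_upwards [self_mem_nhdsWithin] with t ht
    have ht1 : (1 : ℝ) < t := ht
    refine h _ _ (hxy.trans_lt ?_)
    rw [norm_smul, Real.norm_of_nonneg (by linarith)]
    have := norm_pos_iff.2 hy
    nlinarith

/-- The strict bound by `E` leaves room for truncation and mollification before rearranging.
Truncation may lose mass, which the relaxed constraint permits. -/
theorem exists_radially_decreasing_lt {c k N : ℝ} (hk : 0 ≤ k) {ρ : R3 → ℝ}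
    (hρ : IsSubDensity N ρ) {E : ℝ} (hE : functional c k ρ < E) :
    ∃ u : R3 → ℝ, IsSubDensity N u ∧ functional c k u < E ∧ ∀ x y, ‖x‖ ≤ ‖y‖ → u y ≤ u x := by
  let f : ℕ → R3 → ℝ := fun n x => min (ρ x) (ballFun n n x)
  have hfm : ∀ n, Measurable (f n) := fun n => hρ.measurable.min (measurable_ballFun _ _)
  have hf0 : ∀ n x, 0 ≤ f n x := fun n x =>
    le_min (hρ.nonneg x) (ballFun_nonneg (Nat.cast_nonneg n) _ _)
  have hfle : ∀ n x, f n x ≤ ρ x := fun n x => min_le_left _ _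
  have h1 := tendsto_functional c k hfm hf0 hfle hρ.measurable hρ.integrable hρ.integrable_rpow
    (Eventually.of_forall fun x => tendsto_min_ballFun (ρ x) x)
  obtain ⟨n, hn⟩ := (h1.eventually_lt_const hE).exists
  obtain ⟨g, hgc, hg0, hgB, hgi, hglim⟩ := exists_continuous_approx
    (Nat.cast_nonneg n) (hfm n) (hf0 n) (R := n) (fun x => min_le_right _ _)
  have h2 := tendsto_functional c k (fun m => (hgc m).measurable) hg0 hgB (measurable_ballFun _ _)
    (integrable_ballFun _ _) (integrable_ballFun_rpow _ _ (by norm_num)) hglim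
  obtain ⟨m, hm⟩ := (h2.eventually_lt_const hn).exists
  have hgs : HasCompactSupport (g m) := by
    refine HasCompactSupport.intro (isCompact_closedBall (0 : R3) (n + 1)) fun x hx => ?_
    refine le_antisymm ((hgB m x).trans_eq (ballFun_of_lt ?_)) (hg0 m x)
    simpa using hx
  obtain ⟨u, huc, hus, hu0, hu1, hu2, hu3, hu4⟩ :=
    exists_radially_decreasing (hgc m) hgs (hg0 m)
  refine ⟨u, IsSubDensity.of_continuous huc hus hu0 ?_, ?_,
    fun x y => radially_decreasing_of_lt huc hu4⟩
  · rw [hu1, hgi]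
    refine le_trans (integral_mono_of_nonneg (Eventually.of_forall (hf0 n)) hρ.integrable
      (Eventually.of_forall (hfle n))) hρ.mass_le
  · refine lt_of_le_of_lt ?_ hm
    unfold functional
    rw [hu2]
    gcongr

/-! ### Coercivity -/

/-- The functional controls the kinetic energy of densities of bounded mass. -/
theorem exists_coercive {c k : ℝ} (hc : 0 < c) (hk : 0 ≤ k) {N : ℝ} (hN : 0 ≤ N) :
    ∃ A, ∀ u, IsSubDensity N u → c / 2 * (∫ x, u x ^ (5 / 3 : ℝ)) ≤ functional c k u + A := by
  have hd : 0 < 2 * (k * N + 1) := by positivity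
  -- Small enough that the interaction absorbs at most half of the kinetic term; the `+ 1` covers `k
  -- * N = 0`.
  set s := c / (2 * (k * N + 1)) with hs
  have hs0 : 0 < s := by positivity
  have hks : k * N * s ≤ c / 2 := by
    rw [hs, mul_div_assoc', div_le_div_iff₀ hd two_pos]
    nlinarith
  set W := ∫ x, kernelWeight x with hW
  have hW0 : 0 ≤ W := integral_nonneg kernelWeight_nonneg
  refine ⟨k * (N * (s ^ (-(3 / 2) : ℝ) * W + N)), fun u hu => ?_⟩
  have h1 := coulomb_le hs0 hu.measurable hu.nonneg hu.integrable hu.integrable_rpow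
  have hK : 0 ≤ ∫ x, u x ^ (5 / 3 : ℝ) := integral_nonneg fun x => Real.rpow_nonneg (hu.nonneg x) _
  have hM := hu.mass_nonneg
  have hMN := hu.mass_le
  have h2 : coulomb u ≤ N * (s * (∫ x, u x ^ (5 / 3 : ℝ)) + s ^ (-(3 / 2) : ℝ) * W + N) := by
    refine h1.trans ?_
    gcongr
  have h3 := mul_le_mul_of_nonneg_left h2 hk
  have h4 := mul_le_mul_of_nonneg_right hks hK
  unfold functional
  linarith

/-! ### Compactness of radially decreasing sequences -/

/-- Helly's selection theorem for antitone functions. -/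
theorem exists_subseq_tendsto_of_antitone {h : ℕ → ℝ → ℝ} {b : ℝ → ℝ}
    (hh : ∀ n, Antitone (h n)) (h0 : ∀ n t, 0 ≤ h n t) (hb : ∀ n t, h n t ≤ b t) :
    ∃ φ : ℕ → ℕ, StrictMono φ ∧ ∃ G : ℝ → ℝ, Antitone G ∧ (∀ t, 0 ≤ G t) ∧
      ∃ S : Set ℝ, S.Countable ∧ ∀ t ∉ S, Tendsto (fun n => h (φ n) t) atTop (𝓝 (G t)) := by
  have hK : IsCompact (univ.pi fun q : ℚ => Icc (0 : ℝ) (b q)) :=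
    isCompact_univ_pi fun _ => isCompact_Icc
  obtain ⟨L, hL, φ, hφ, hlim⟩ := hK.tendsto_subseq (x := fun n (q : ℚ) => h n q)
    (fun n q _ => ⟨h0 n q, hb n q⟩)
  have hlim' : ∀ q : ℚ, Tendsto (fun n => h (φ n) q) atTop (𝓝 (L q)) := fun q =>
    (tendsto_pi_nhds.1 hlim) q
  -- The limit on the rationals, extended monotonically from the left; convergence holds wherever
  -- `G` is continuous.
  let G : ℝ → ℝ := fun t => sInf (L '' {q : ℚ | (q : ℝ) < t})
  have hbdd : ∀ t, BddBelow (L '' {q : ℚ | (q : ℝ) < t}) := fun t => by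
    refine ⟨0, ?_⟩
    rintro _ ⟨q, -, rfl⟩
    exact (hL q (mem_univ q)).1
  have hne : ∀ t : ℝ, (L '' {q : ℚ | (q : ℝ) < t}).Nonempty := fun t => by
    obtain ⟨q, hq⟩ := exists_rat_lt t
    exact ⟨L q, q, hq, rfl⟩
  have hGle : ∀ (q : ℚ) (t : ℝ), (q : ℝ) < t → G t ≤ L q := fun q t hq =>
    csInf_le (hbdd t) ⟨q, hq, rfl⟩
  have hG : Antitone G := fun s t hst =>
    csInf_le_csInf (hbdd t) (hne s) (image_mono fun q hq => lt_of_lt_of_le hq hst)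
  refine ⟨φ, hφ, G, hG, fun t => ?_, {t | ¬ContinuousAt G t}, hG.countable_not_continuousAt,
    fun t ht => ?_⟩
  · refine le_csInf (hne t) ?_
    rintro _ ⟨q, -, rfl⟩
    exact (hL q (mem_univ q)).1
  · have hct : ContinuousAt G t := not_not.1 ht
    refine tendsto_order.2 ⟨fun a ha => ?_, fun a ha => ?_⟩
    · have h1 : ∀ᶠ s in 𝓝[>] t, a < G s :=
        (hct.eventually (lt_mem_nhds ha)).filter_mono nhdsWithin_le_nhds
      obtain ⟨s, hs, hts⟩ := (h1.and self_mem_nhdsWithin).exists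
      obtain ⟨q, hq1, hq2⟩ := exists_rat_btwn (show t < s from hts)
      filter_upwards [(hlim' q).eventually (lt_mem_nhds (hs.trans_le (hGle q s hq2)))] with n hn
      exact hn.trans_le (hh _ hq1.le)
    · obtain ⟨_, ⟨q, hq, rfl⟩, hqa⟩ := exists_lt_of_csInf_lt (hne t) ha
      filter_upwards [(hlim' q).eventually (gt_mem_nhds hqa)] with n hn
      exact (hh _ (le_of_lt hq)).trans_lt hn

/-- Fatou's lemma for nonnegative functions with bounded Bochner integrals. -/
theorem integrable_and_integral_le_of_tendsto {u : ℕ → R3 → ℝ} {v : R3 → ℝ} {A : ℝ}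
    (hu : ∀ n, Integrable (u n)) (h0 : ∀ n x, 0 ≤ u n x) (hv : Measurable v)
    (hv0 : ∀ x, 0 ≤ v x) (hA : ∀ᶠ n in atTop, ∫ x, u n x ≤ A)
    (hlim : ∀ᵐ x, Tendsto (fun n => u n x) atTop (𝓝 (v x))) :
    Integrable v ∧ ∫ x, v x ≤ A := by
  have hA0 : 0 ≤ A := by
    obtain ⟨n, hn⟩ := hA.exists
    exact (integral_nonneg (h0 n)).trans hn
  have h1 : ∫⁻ x, ENNReal.ofReal (v x) ≤ ENNReal.ofReal A := by
    calc ∫⁻ x, ENNReal.ofReal (v x)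
        = ∫⁻ x, liminf (fun n => ENNReal.ofReal (u n x)) atTop := by
          refine lintegral_congr_ae ?_
          filter_upwards [hlim] with x hx
          exact (ENNReal.tendsto_ofReal hx).liminf_eq.symm
      _ ≤ liminf (fun n => ∫⁻ x, ENNReal.ofReal (u n x)) atTop :=
          lintegral_liminf_le' fun n => (hu n).aemeasurable.ennreal_ofReal
      _ ≤ ENNReal.ofReal A := by
          refine liminf_le_of_frequently_le' (Eventually.frequently ?_)
          filter_upwards [hA] with n hn
          rw [← ofReal_integral_eq_lintegral_ofReal (hu n) (Eventually.of_forall (h0 n))]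
          exact ENNReal.ofReal_le_ofReal hn
  have hvi : Integrable v := by
    refine ⟨hv.aestronglyMeasurable, ?_⟩
    rw [hasFiniteIntegral_iff_ofReal (Eventually.of_forall hv0)]
    exact h1.trans_lt ENNReal.ofReal_lt_top
  refine ⟨hvi, ?_⟩
  rw [← ofReal_integral_eq_lintegral_ofReal hvi (Eventually.of_forall hv0)] at h1
  exact (ENNReal.ofReal_le_ofReal_iff hA0).1 h1

/-- The volume of the unit ball. -/
noncomputable def unitBallVolume : ℝ := volume.real (Metric.ball (0 : R3) 1)

theorem unitBallVolume_pos : 0 < unitBallVolume :=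
  ENNReal.toReal_pos (Metric.measure_ball_pos volume _ one_pos).ne' measure_ball_lt_top.ne

theorem volume_closedBall {r : ℝ} (hr : 0 ≤ r) :
    volume.real (Metric.closedBall (0 : R3) r) = r ^ 3 * unitBallVolume := by
  unfold unitBallVolume
  rw [measureReal_def, measureReal_def, Measure.addHaar_closedBall _ _ hr, ENNReal.toReal_mul,
    ENNReal.toReal_ofReal (by positivity)]
  simp

/-- On the ball of radius `‖x‖` the function is at least `f x`, so its integral there bounds `f x`
times the volume. -/
theorem radially_decreasing_le {f : R3 → ℝ} (hf : Integrable f) (h0 : ∀ x, 0 ≤ f x)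
    (hr : ∀ x y, ‖x‖ ≤ ‖y‖ → f y ≤ f x) {A : ℝ} (hA : ∫ x, f x ≤ A) {x : R3} (hx : x ≠ 0) :
    f x ≤ A / unitBallVolume * ‖x‖ ^ (-3 : ℝ) := by
  have hxn := norm_pos_iff.2 hx
  have h1 : f x * (‖x‖ ^ 3 * unitBallVolume) ≤ A := by
    calc f x * (‖x‖ ^ 3 * unitBallVolume)
        = ∫ _ in Metric.closedBall (0 : R3) ‖x‖, f x := by
          rw [setIntegral_const, volume_closedBall hxn.le, smul_eq_mul, mul_comm]
      _ ≤ ∫ y in Metric.closedBall (0 : R3) ‖x‖, f y :=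
          setIntegral_mono_on (integrableOn_const (hs := measure_closedBall_lt_top.ne))
            hf.integrableOn measurableSet_closedBall fun y hy => hr _ _ (by simpa using hy)
      _ ≤ ∫ y, f y := setIntegral_le_integral hf (Eventually.of_forall h0)
      _ ≤ A := hA
  rw [Real.rpow_neg hxn.le, ← div_eq_mul_inv]
  norm_cast
  rw [div_div, le_div_iff₀ (mul_pos unitBallVolume_pos (by positivity))]
  linarith

/-- A common majorant for radially decreasing densities. -/
noncomputable def radialMajorant (D : ℝ) (x : R3) : ℝ :=
  D * if ‖x‖ < 1 then ‖x‖ ^ (-(9 / 5) : ℝ) else ‖x‖ ^ (-3 : ℝ)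

theorem radialMajorant_nonneg {D : ℝ} (hD : 0 ≤ D) (x : R3) : 0 ≤ radialMajorant D x := by
  unfold radialMajorant
  split_ifs <;> positivity

theorem measurable_radialMajorant (D : ℝ) : Measurable (radialMajorant D) :=
  measurable_const.mul (Measurable.ite (measurableSet_lt measurable_norm measurable_const)
    (measurable_norm.pow_const _) (measurable_norm.pow_const _))

/-- The condition `a < 5/3` is used at the origin, `1 < a` at infinity. -/
theorem integrable_radialMajorant_rpow {D : ℝ} (hD : 0 ≤ D) {a : ℝ} (h1 : 1 < a)
    (h2 : a < 5 / 3) : Integrable fun x => radialMajorant D x ^ a := by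
  refine ((integrable_radial_power (p := 9 / 5 * a) (q := 3 * a) (by linarith)
    (by linarith)).const_mul (D ^ a)).congr (Eventually.of_forall fun x => ?_)
  simp only [radialMajorant]
  split_ifs
  · rw [Real.mul_rpow hD (by positivity), ← Real.rpow_mul (norm_nonneg _)]; ring_nf
  · rw [Real.mul_rpow hD (by positivity), ← Real.rpow_mul (norm_nonneg _)]; ring_nf

theorem integrable_coulombIntegrand_radialMajorant {D : ℝ} (hD : 0 ≤ D) :
    Integrable (coulombIntegrand (radialMajorant D)) :=
  integrable_coulombIntegrand (measurable_radialMajorant D) (radialMajorant_nonneg hD)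
    (integrable_radialMajorant_rpow hD (by norm_num) (by norm_num))
    (integrable_radialMajorant_rpow hD (by norm_num) (by norm_num))
    (integrable_radialMajorant_rpow hD (by norm_num) (by norm_num))

/-- Apply `radially_decreasing_le` to `u^(5/3)` inside the unit ball, which gives the power `-3 *
(3/5) = -9/5`, and to `u` itself outside. -/
theorem exists_le_radialMajorant {N K : ℝ} :
    ∃ D, 0 ≤ D ∧ ∀ u, IsSubDensity N u → (∀ x y, ‖x‖ ≤ ‖y‖ → u y ≤ u x) →
      ∫ x, u x ^ (5 / 3 : ℝ) ≤ K → ∀ x ≠ 0, u x ≤ radialMajorant D x := by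
  have hω := unitBallVolume_pos
  refine ⟨max (|N| / unitBallVolume) ((|K| / unitBallVolume) ^ (3 / 5 : ℝ)),
    le_max_of_le_left (by positivity), fun u hu hr hK x hx => ?_⟩
  have hxn := norm_pos_iff.2 hx
  unfold radialMajorant
  split_ifs
  · have h1 := radially_decreasing_le hu.integrable_rpow
      (fun x => Real.rpow_nonneg (hu.nonneg x) _)
      (fun x y h => Real.rpow_le_rpow (hu.nonneg y) (hr x y h) (by norm_num))
      (hK.trans (le_abs_self K)) hx
    have h2 := Real.rpow_le_rpow (Real.rpow_nonneg (hu.nonneg x) _) h1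
      (by norm_num : (0 : ℝ) ≤ 3 / 5)
    rw [← Real.rpow_mul (hu.nonneg x), Real.mul_rpow (by positivity) (by positivity),
      ← Real.rpow_mul hxn.le] at h2
    norm_num at h2
    refine h2.trans ?_
    norm_num
    gcongr
    exact le_max_right _ _
  · refine (radially_decreasing_le hu.integrable hu.nonneg hr
      (hu.mass_le.trans (le_abs_self N)) hx).trans ?_
    gcongr
    exact le_max_left _ _

/-- Radially decreasing sequences that are locally bounded away from the origin have a
subsequence that converges almost everywhere. -/
theorem exists_subseq_tendsto_ae {u : ℕ → R3 → ℝ} {B : R3 → ℝ} (h0 : ∀ n x, 0 ≤ u n x)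
    (hr : ∀ n x y, ‖x‖ ≤ ‖y‖ → u n y ≤ u n x) (hB : ∀ n, ∀ x ≠ 0, u n x ≤ B x) :
    ∃ φ : ℕ → ℕ, StrictMono φ ∧ ∃ v : R3 → ℝ, Measurable v ∧ (∀ x, 0 ≤ v x) ∧
      ∀ᵐ x, Tendsto (fun n => u (φ n) x) atTop (𝓝 (v x)) := by
  let e : R3 := EuclideanSpace.single 0 1
  have he : ‖e‖ = 1 := by simp [e]
  have hne : ∀ t : ℝ, ‖Real.exp t • e‖ = Real.exp t := fun t => by
    rw [norm_smul, he, mul_one, Real.norm_of_nonneg (Real.exp_pos t).le]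
  -- The logarithm of the radius as variable turns `(0, ∞)` into the whole line and avoids the
  -- origin, where the bound `B` is not assumed.
  obtain ⟨φ, hφ, G, hG, hG0, S, hS, hlim⟩ := exists_subseq_tendsto_of_antitone
    (h := fun n t => u n (Real.exp t • e)) (b := fun t => B (Real.exp t • e))
    (fun n s t hst => hr n _ _ (by rw [hne, hne]; exact Real.exp_le_exp.2 hst))
    (fun n t => h0 n _)
    (fun n t => hB n _ (norm_pos_iff.1 (by rw [hne]; exact Real.exp_pos t)))
  refine ⟨φ, hφ, fun x => G (Real.log ‖x‖),
    hG.measurable.comp (Real.measurable_log.comp measurable_norm), fun x => hG0 _, ?_⟩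
  have hnull : volume ({0} ∪ ⋃ s ∈ S, Metric.sphere (0 : R3) (Real.exp s)) = 0 := by
    refine measure_union_null (measure_singleton _) ?_
    rw [measure_biUnion_null_iff hS]
    exact fun s _ => Measure.addHaar_sphere _ _ _
  filter_upwards [compl_mem_ae_iff.2 hnull] with x hx
  simp only [mem_compl_iff, mem_union, mem_singleton_iff, mem_iUnion, not_or, not_exists] at hx
  have hxn := norm_pos_iff.2 hx.1
  have hxS : Real.log ‖x‖ ∉ S := fun h => hx.2 _ h (by simp [Real.exp_log hxn])
  refine (hlim _ hxS).congr fun n => ?_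
  have : ‖Real.exp (Real.log ‖x‖) • e‖ = ‖x‖ := by rw [hne, Real.exp_log hxn]
  exact le_antisymm (hr _ _ _ this.ge) (hr _ _ _ this.le)

/-! ### The relaxed problem -/

/-- The relaxed problem, with mass at most `N`, has a minimizer. -/
theorem exists_relaxed_minimizer {c k N : ℝ} (hc : 0 < c) (hk : 0 ≤ k) (hN : 0 ≤ N) :
    ∃ v, IsSubDensity N v ∧ ∀ ρ, IsSubDensity N ρ → functional c k v ≤ functional c k ρ := by
  obtain ⟨A, hA⟩ := exists_coercive hc hk hN
  let F : Set ℝ := functional c k '' {u | IsSubDensity N u}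
  have hF0 : F.Nonempty := ⟨_, fun _ => 0, ⟨measurable_const, fun _ => le_rfl, integrable_zero _ _ _,
    by simp, by simpa using hN⟩, rfl⟩
  have hFb : BddBelow F := by
    refine ⟨-A, ?_⟩
    rintro _ ⟨u, hu, rfl⟩
    have := hA u hu
    have : 0 ≤ ∫ x, u x ^ (5 / 3 : ℝ) := integral_nonneg fun x => Real.rpow_nonneg (hu.nonneg x) _
    have : 0 ≤ c / 2 * ∫ x, u x ^ (5 / 3 : ℝ) := by positivity
    linarith
  have hseq : ∀ n : ℕ, ∃ u, IsSubDensity N u ∧ functional c k u < sInf F + 1 / (n + 1) ∧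
      ∀ x y, ‖x‖ ≤ ‖y‖ → u y ≤ u x := by
    intro n
    obtain ⟨_, ⟨ρ, hρ, rfl⟩, h⟩ := exists_lt_of_csInf_lt hF0
      (lt_add_of_pos_right (sInf F) (by positivity : (0 : ℝ) < 1 / (n + 1)))
    exact exists_radially_decreasing_lt hk hρ h
  choose u hu huF hur using hseq
  have hK : ∀ n, ∫ x, u n x ^ (5 / 3 : ℝ) ≤ (sInf F + 1 + A) / (c / 2) := by
    intro n
    rw [le_div_iff₀ (by positivity), mul_comm]
    have h1 := hA _ (hu n)
    have h2 : (1 : ℝ) / (n + 1) ≤ 1 := by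
      rw [div_le_one (by positivity)]
      linarith [(by positivity : (0 : ℝ) ≤ n)]
    linarith [huF n]
  obtain ⟨D, hD, hDu⟩ := exists_le_radialMajorant (N := N) (K := (sInf F + 1 + A) / (c / 2))
  have hle : ∀ n, ∀ x ≠ 0, u n x ≤ radialMajorant D x := fun n => hDu _ (hu n) (hur n) (hK n)
  obtain ⟨φ, hφ, v, hvm, hv0, hlim⟩ :=
    exists_subseq_tendsto_ae (fun n => (hu n).nonneg) hur hle
  have hJ : Tendsto (fun n => coulomb (u (φ n))) atTop (𝓝 (coulomb v)) :=
    tendsto_coulomb (fun n => (hu _).measurable) (fun n => (hu _).nonneg)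
      (fun n => by
        filter_upwards [compl_mem_ae_iff.2 (measure_singleton (0 : R3))] with x hx
        exact hle _ x hx)
      (integrable_coulombIntegrand_radialMajorant hD) hlim
  have hE : Tendsto (fun n => functional c k (u n)) atTop (𝓝 (sInf F)) := by
    refine tendsto_of_tendsto_of_tendsto_of_le_of_le tendsto_const_nhds
      (by simpa using tendsto_one_div_add_atTop_nhds_zero_nat.const_add (sInf F))
      (fun n => csInf_le hFb ⟨_, hu n, rfl⟩) (fun n => (huF n).le)
  -- Energy and interaction converge, hence so does the kinetic energy. Fatou is then applied with
  -- every bound `B` strictly above this limit, since the kinetic energies are only eventually below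
  -- `B`.
  have hKlim : Tendsto (fun n => ∫ x, u (φ n) x ^ (5 / 3 : ℝ)) atTop
      (𝓝 ((sInf F + k * coulomb v) / c)) := by
    refine (((hE.comp hφ.tendsto_atTop).add (hJ.const_mul k)).div_const c).congr fun n => ?_
    simp only [Function.comp, functional]
    field_simp
    ring
  have hmass := integrable_and_integral_le_of_tendsto (fun n => (hu (φ n)).integrable)
    (fun n => (hu _).nonneg) hvm hv0 (Eventually.of_forall fun n => (hu _).mass_le) hlim
  have hkin : ∀ B, (sInf F + k * coulomb v) / c < B →
      Integrable (fun x => v x ^ (5 / 3 : ℝ)) ∧ ∫ x, v x ^ (5 / 3 : ℝ) ≤ B := fun B hB => by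
    refine integrable_and_integral_le_of_tendsto (fun n => (hu (φ n)).integrable_rpow)
      (fun n x => Real.rpow_nonneg ((hu _).nonneg x) _) (hvm.pow_const _)
      (fun x => Real.rpow_nonneg (hv0 x) _)
      ((hKlim.eventually_lt_const hB).mono fun n hn => hn.le) ?_
    filter_upwards [hlim] with x hx
    exact hx.rpow_const (Or.inr (by norm_num))
  have hKv : ∫ x, v x ^ (5 / 3 : ℝ) ≤ (sInf F + k * coulomb v) / c :=
    le_of_forall_gt_imp_ge_of_dense fun B hB => (hkin B hB).2
  refine ⟨v, ⟨hvm, hv0, hmass.1, (hkin _ (lt_add_one _)).1, hmass.2⟩, fun ρ hρ => ?_⟩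
  refine le_trans ?_ (csInf_le hFb ⟨ρ, hρ, rfl⟩)
  rw [le_div_iff₀ hc] at hKv
  unfold functional
  linarith

/-! ### Scaling and conservation of mass -/

theorem finrank_R3 : Module.finrank ℝ R3 = 3 := by simp

theorem integral_comp_smul_R3 (f : R3 → ℝ) {l : ℝ} (hl : 0 < l) :
    ∫ x, f (l • x) = (l ^ 3)⁻¹ * ∫ x, f x := by
  rw [Measure.integral_comp_smul_of_nonneg volume f l (hR := hl.le), finrank_R3, smul_eq_mul]

/-- The two volume elements give `l^(-6)` and the kernel gives back one factor `l`. -/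
theorem coulomb_comp_smul (u : R3 → ℝ) (a : ℝ) {l : ℝ} (hl : 0 < l) :
    coulomb (fun x => a * u (l • x)) = a ^ 2 * (l ^ 5)⁻¹ * coulomb u := by
  have h1 : ∀ p : R3 × R3, coulombIntegrand (fun x => a * u (l • x)) p =
      (a ^ 2 * l) * coulombIntegrand u (l • p) := by
    intro p
    simp only [coulombIntegrand, Prod.smul_fst, Prod.smul_snd]
    rw [← smul_sub, norm_smul, Real.norm_of_nonneg hl.le]
    field_simp
  unfold coulomb
  simp only [h1]
  have : (volume : Measure (R3 × R3)).IsAddHaarMeasure := by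
    rw [Measure.volume_eq_prod]; infer_instance
  rw [integral_const_mul, Measure.integral_comp_smul_of_nonneg volume _ l (hR := hl.le),
    Module.finrank_prod, finrank_R3, smul_eq_mul]
  field_simp

theorem integral_rpow_comp_smul {u : R3 → ℝ} (h0 : ∀ x, 0 ≤ u x) {a : ℝ} (ha : 0 ≤ a) {l : ℝ}
    (hl : 0 < l) : ∫ x, (a * u (l • x)) ^ (5 / 3 : ℝ) =
      a ^ (5 / 3 : ℝ) * (l ^ 3)⁻¹ * ∫ x, u x ^ (5 / 3 : ℝ) := by
  simp only [Real.mul_rpow ha (h0 _)]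
  rw [integral_const_mul, integral_comp_smul_R3 (fun x => u x ^ (5 / 3 : ℝ)) hl]
  ring

theorem IsSubDensity.comp_smul {N N' : ℝ} {u : R3 → ℝ} (hu : IsSubDensity N u) {a : ℝ}
    (ha : 0 ≤ a) {l : ℝ} (hl : 0 < l) (hN : a * ((l ^ 3)⁻¹ * ∫ x, u x) ≤ N') :
    IsSubDensity N' fun x => a * u (l • x) where
  measurable := measurable_const.mul (hu.measurable.comp (measurable_const_smul l))
  nonneg x := mul_nonneg ha (hu.nonneg _)
  integrable := (hu.integrable.comp_smul hl.ne').const_mul a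
  integrable_rpow := by
    simp only [Real.mul_rpow ha (hu.nonneg _)]
    exact (hu.integrable_rpow.comp_smul hl.ne').const_mul _
  mass_le := by rwa [integral_const_mul, integral_comp_smul_R3 u hl]

theorem functional_comp_smul {c k : ℝ} {u : R3 → ℝ} (h0 : ∀ x, 0 ≤ u x) {a : ℝ} (ha : 0 ≤ a)
    {l : ℝ} (hl : 0 < l) : functional c k (fun x => a * u (l • x)) =
      c * (a ^ (5 / 3 : ℝ) * (l ^ 3)⁻¹ * ∫ x, u x ^ (5 / 3 : ℝ)) -
        k * (a ^ 2 * (l ^ 5)⁻¹ * coulomb u) := by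
  unfold functional
  rw [integral_rpow_comp_smul h0 ha hl, coulomb_comp_smul u a hl]

theorem integral_unit_ballFun : ∫ x, ballFun 1 1 x = unitBallVolume := by
  unfold ballFun
  rw [integral_indicator_const _ measurableSet_closedBall, volume_closedBall zero_le_one]
  simp

theorem isSubDensity_unit_ballFun : IsSubDensity unitBallVolume (ballFun 1 1) where
  measurable := measurable_ballFun 1 1
  nonneg := ballFun_nonneg zero_le_one 1
  integrable := integrable_ballFun 1 1
  integrable_rpow := integrable_ballFun_rpow 1 1 (by norm_num)
  mass_le := integral_unit_ballFun.le

theorem coulomb_unit_ballFun_pos : 0 < coulomb (ballFun 1 1) := by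
  have hi := (integrable_ballFun 1 1).mul_prod (integrable_ballFun 1 1)
  have h1 : ∫ p : R3 × R3, 1 / 2 * (ballFun 1 1 p.1 * ballFun 1 1 p.2) =
      1 / 2 * (unitBallVolume * unitBallVolume) := by
    rw [integral_const_mul, Measure.volume_eq_prod, integral_prod_mul (ballFun 1 1) (ballFun 1 1),
      integral_unit_ballFun]
  have h2 := unitBallVolume_pos
  refine (by positivity : 0 < 1 / 2 * (unitBallVolume * unitBallVolume)).trans_le ?_
  rw [← h1]
  refine integral_mono_ae (hi.const_mul _) (integrable_coulombIntegrand_ballFun zero_le_one 1) ?_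
  filter_upwards [IsAffineReflection.ae_snd_ne_comp_fst measurable_id] with p hp
  rcases le_or_gt ‖p.1‖ 1 with hx | hx
  · rcases le_or_gt ‖p.2‖ 1 with hy | hy
    · simp only [coulombIntegrand, ballFun_of_le hx, ballFun_of_le hy]
      have hpos : 0 < ‖p.1 - p.2‖ := norm_pos_iff.2 (sub_ne_zero.2 (Ne.symm hp))
      have hle : ‖p.1 - p.2‖ ≤ 2 := (norm_sub_le _ _).trans (by linarith)
      rw [mul_one, mul_one]
      exact one_div_le_one_div_of_le hpos hle
    · simp [coulombIntegrand, ballFun_of_lt hy]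
  · simp [coulombIntegrand, ballFun_of_lt hx]

/-- Under mass-preserving dilation of a ball the kinetic term scales like `l^2` and the interaction
like `l`, so the attraction wins for small `l`. -/
theorem exists_functional_neg {c k N : ℝ} (hc : 0 < c) (hk : 0 < k) (hN : 0 < N) :
    ∃ u, IsSubDensity N u ∧ functional c k u < 0 := by
  have hω := unitBallVolume_pos
  have hJ := coulomb_unit_ballFun_pos
  have hK : ∫ x, ballFun 1 1 x ^ (5 / 3 : ℝ) = unitBallVolume := by
    simp only [ballFun_rpow 1 1 (show (5 / 3 : ℝ) ≠ 0 by norm_num), Real.one_rpow]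
    exact integral_unit_ballFun
  set b := N / unitBallVolume with hb
  have hb0 : 0 < b := by positivity
  set α := c * (b ^ (5 / 3 : ℝ) * unitBallVolume) with hα
  set β := k * (b ^ 2 * coulomb (ballFun 1 1)) with hβ
  have hα0 : 0 < α := by positivity
  have hβ0 : 0 < β := by positivity
  -- The energy of the dilated ball is `l * (α * l - β)`; this `l` is half of its positive zero.
  set l := β / (2 * α) with hl
  have hl0 : 0 < l := by positivity
  have ha0 : 0 ≤ b * l ^ 3 := by positivity
  refine ⟨fun x => b * l ^ 3 * ballFun 1 1 (l • x),
    isSubDensity_unit_ballFun.comp_smul ha0 hl0 ?_, ?_⟩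
  · rw [integral_unit_ballFun, hb]
    apply le_of_eq
    field_simp
  · rw [functional_comp_smul (ballFun_nonneg zero_le_one 1) ha0 hl0, hK,
      Real.mul_rpow hb0.le (by positivity)]
    have h5 : (l ^ 3) ^ (5 / 3 : ℝ) = l ^ 5 := by
      rw [← Real.rpow_natCast, ← Real.rpow_natCast, ← Real.rpow_mul hl0.le]
      norm_num
    rw [h5]
    have h6 : c * (b ^ (5 / 3 : ℝ) * l ^ 5 * (l ^ 3)⁻¹ * unitBallVolume) -
        k * ((b * l ^ 3) ^ 2 * (l ^ 5)⁻¹ * coulomb (ballFun 1 1)) = l * (α * l - β) := by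
      rw [hα, hβ]
      field_simp
    rw [h6]
    have h7 : α * l = β / 2 := by rw [hl]; field_simp
    rw [h7]
    exact mul_neg_of_pos_of_neg hl0 (by linarith)

/-- Dilating a density of negative energy lowers its energy, so that minimizers of the relaxed
problem have full mass. -/
theorem exists_minimizer {c k N : ℝ} (hc : 0 < c) (hk : 0 < k) (hN : 0 < N) :
    ∃ v, IsSubDensity N v ∧ ∫ x, v x = N ∧
      ∀ ρ, IsSubDensity N ρ → functional c k v ≤ functional c k ρ := by
  obtain ⟨v, hv, hmin⟩ := exists_relaxed_minimizer hc hk.le hN.le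
  refine ⟨v, hv, ?_, hmin⟩
  by_contra hne
  have hlt : ∫ x, v x < N := lt_of_le_of_ne hv.mass_le hne
  obtain ⟨w, hw, hwneg⟩ := exists_functional_neg hc hk hN
  have hneg := (hmin w hw).trans_lt hwneg
  have hK : 0 ≤ ∫ x, v x ^ (5 / 3 : ℝ) := integral_nonneg fun x => Real.rpow_nonneg (hv.nonneg x) _
  have hcont : Tendsto (fun l : ℝ => (l ^ 3)⁻¹ * ∫ x, v x) (𝓝[<] 1)
      (𝓝 (((1 : ℝ) ^ 3)⁻¹ * ∫ x, v x)) :=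
    (((tendsto_id.mono_left nhdsWithin_le_nhds).pow 3).inv₀ (by norm_num)).mul_const _
  rw [one_pow, inv_one, one_mul] at hcont
  -- A dilation `l < 1` so close to 1 that the increased mass is still below `N`.
  obtain ⟨l, ⟨hl, hl1⟩, hl0⟩ := ((hcont.eventually_lt_const hlt).and self_mem_nhdsWithin |>.and
    (nhdsWithin_le_nhds (lt_mem_nhds zero_lt_one))).exists
  have hl1' : l < 1 := hl1
  have hd := hmin _ (hv.comp_smul zero_le_one hl0 (by rw [one_mul]; exact hl.le))
  rw [functional_comp_smul hv.nonneg zero_le_one hl0] at hd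
  have hinv : 1 < l⁻¹ := (one_lt_inv₀ hl0).2 hl1'
  have hp3 : 1 < l⁻¹ ^ 3 := one_lt_pow₀ hinv (by norm_num)
  have hp2 : 1 < l⁻¹ ^ 2 := one_lt_pow₀ hinv (by norm_num)
  unfold functional at hd hneg
  simp only [Real.one_rpow, one_pow, one_mul] at hd
  rw [← inv_pow, ← inv_pow] at hd
  -- The energy is negative and its kinetic part nonnegative. With `λ = l⁻¹ > 1`, kinetic term `T`
  -- and interaction term `P`, the dilated energy is `λ^3 (T - P) - λ^3 (λ^2 - 1) P`, which is below
  -- `T - P`.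
  have hkJ : 0 < k * coulomb v := by nlinarith
  have e1 := mul_pos (sub_pos.2 hp3) (neg_pos.2 hneg)
  have e2 := mul_pos (mul_pos (by positivity : 0 < l⁻¹ ^ 3) (sub_pos.2 hp2)) hkJ
  have e3 : l⁻¹ ^ 5 = l⁻¹ ^ 3 * l⁻¹ ^ 2 := by ring
  rw [e3] at hd
  linarith

/-! ### Return to the physical energy and admissible densities -/

/-- The constant in `j_∞(r) = C r^(5/3)`. -/
noncomputable def kineticConst (q m : ℝ) : ℝ :=
  q / (8 * Real.pi ^ 3) * (((6 * Real.pi ^ 2 / q) ^ (1 / 3 : ℝ)) ^ 5 *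
    ∫ p in Metric.ball (0 : R3) 1, ‖p‖ ^ 2 / (2 * m))

theorem kineticConst_pos {q m : ℝ} (hq : 0 < q) (hm : 0 < m) : 0 < kineticConst q m := by
  have h : 0 < ∫ p in Metric.ball (0 : R3) 1, ‖p‖ ^ 2 / (2 * m) := by
    rw [setIntegral_pos_iff_support_of_nonneg_ae
      (Eventually.of_forall fun p => by positivity)]
    · have : Function.support (fun p : R3 => ‖p‖ ^ 2 / (2 * m)) ∩ Metric.ball 0 1 =
          Metric.ball 0 1 \ {0} := by
        ext p
        simp [hm.ne', and_comm]
      rw [this, measure_sdiff_null (measure_singleton _)]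
      exact Metric.measure_ball_pos _ _ one_pos
    · refine (ContinuousOn.integrableOn_compact (isCompact_closedBall (0 : R3) 1)
        (by fun_prop)).mono_set Metric.ball_subset_closedBall
  unfold kineticConst
  positivity

/-- Rescaling the Fermi ball to the unit ball gives the fifth power of the Fermi momentum, that is,
`r^(5/3)`. The unit-ball integral need not be evaluated, only its positivity matters. -/
theorem kineticDensity_eq {q m r : ℝ} (hq : 0 < q) (hr : 0 ≤ r) :
    kineticDensity q m r = kineticConst q m * r ^ (5 / 3 : ℝ) := by
  have hη : fermiMomentum q r = (6 * Real.pi ^ 2 / q) ^ (1 / 3 : ℝ) * r ^ (1 / 3 : ℝ) := by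
    unfold fermiMomentum
    rw [← Real.mul_rpow (by positivity) hr]
    congr 1
    ring
  have hη0 : 0 ≤ fermiMomentum q r := Real.rpow_nonneg (by positivity) _
  have h5 : fermiMomentum q r ^ 5 =
      ((6 * Real.pi ^ 2 / q) ^ (1 / 3 : ℝ)) ^ 5 * r ^ (5 / 3 : ℝ) := by
    rw [hη, mul_pow]
    congr 1
    rw [← Real.rpow_natCast, ← Real.rpow_mul hr]
    norm_num
  have key : ∫ p in Metric.ball (0 : R3) (fermiMomentum q r), ‖p‖ ^ 2 / (2 * m) =
      fermiMomentum q r ^ 5 * ∫ p in Metric.ball (0 : R3) 1, ‖p‖ ^ 2 / (2 * m) := by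
    rcases hη0.eq_or_lt with h | h
    · rw [← h]; simp
    · have h1 := Measure.setIntegral_comp_smul_of_pos volume
        (fun p : R3 => ‖p‖ ^ 2 / (2 * m)) (Metric.ball 0 1) h
      rw [smul_unitBall_of_pos h, finrank_R3, smul_eq_mul] at h1
      have h2 : ∀ p : R3, ‖fermiMomentum q r • p‖ ^ 2 / (2 * m) =
          fermiMomentum q r ^ 2 * (‖p‖ ^ 2 / (2 * m)) := fun p => by
        rw [norm_smul, mul_pow, Real.norm_of_nonneg hη0]; ring
      simp only [h2] at h1
      rw [integral_const_mul] at h1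
      field_simp at h1
      linear_combination -h1
  unfold kineticDensity kineticConst
  rw [key, h5]
  ring

theorem energy_eq_functional {q m κ : ℝ} (hq : 0 < q) {N : ℝ} {u : R3 → ℝ}
    (hu : IsSubDensity N u) :
    energy q m κ u = functional (kineticConst q m) (κ / 2) u := by
  unfold energy functional selfEnergy
  have h1 : ∫ x, kineticDensity q m (u x) = kineticConst q m * ∫ x, u x ^ (5 / 3 : ℝ) := by
    rw [← integral_const_mul]
    exact integral_congr_ae (Eventually.of_forall fun x => kineticDensity_eq hq (hu.nonneg x))
  have h2 : coulomb u = ∫ x, ∫ y, u x * u y / ‖x - y‖ := by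
    have := integrable_coulombIntegrand' hu.measurable hu.nonneg hu.integrable hu.integrable_rpow
    unfold coulomb
    rw [Measure.volume_eq_prod] at this ⊢
    exact integral_prod _ this
  rw [h1, h2]
  ring

theorem energy_congr_ae {q m κ : ℝ} {u v : R3 → ℝ} (h : u =ᵐ[volume] v) :
    energy q m κ u = energy q m κ v := by
  unfold energy selfEnergy
  congr 1
  · refine integral_congr_ae ?_
    filter_upwards [h] with x hx
    rw [hx]
  · congr 2
    refine integral_congr_ae ?_
    filter_upwards [h] with x hx
    refine integral_congr_ae ?_
    filter_upwards [h] with y hy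
    rw [hx, hy]

theorem toReal_five_thirds : (5 / 3 : ℝ≥0∞).toReal = 5 / 3 := by simp

/-- The positive part of a measurable representative; the energy depends only on the a.e. class. -/
theorem IsAdmissible.exists_isSubDensity {N : ℝ} {ρ : R3 → ℝ} (h : IsAdmissible N ρ) :
    ∃ u, IsSubDensity N u ∧ ρ =ᵐ[volume] u := by
  have hm := h.integrable.aestronglyMeasurable
  let u : R3 → ℝ := fun x => max (hm.mk ρ x) 0
  have hu : ρ =ᵐ[volume] u := by
    filter_upwards [hm.ae_eq_mk, h.nonneg] with x hx h0
    simp only [u]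
    rw [← hx, max_eq_left h0]
  have hu0 : ∀ x, 0 ≤ u x := fun x => le_max_right _ _
  refine ⟨u, ⟨hm.stronglyMeasurable_mk.measurable.max measurable_const, hu0,
    h.integrable.congr hu, ?_, ?_⟩, hu⟩
  · have := ((memLp_congr_ae hu).1 h.memLp).integrable_norm_rpow (by simp)
      (ENNReal.div_ne_top (by simp) (by simp))
    rw [toReal_five_thirds] at this
    simpa only [Real.norm_of_nonneg (hu0 _)] using this
  · rw [← integral_congr_ae hu, h.mass]

theorem IsSubDensity.isAdmissible {N : ℝ} {u : R3 → ℝ} (h : IsSubDensity N u)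
    (hN : ∫ x, u x = N) : IsAdmissible N u where
  nonneg := Eventually.of_forall h.nonneg
  integrable := h.integrable
  memLp := by
    rw [← integrable_norm_rpow_iff h.measurable.aestronglyMeasurable (by simp)
      (ENNReal.div_ne_top (by simp) (by simp)), toReal_five_thirds]
    simpa only [Real.norm_of_nonneg (h.nonneg _)] using h.integrable_rpow
  mass := hN

end NeutronStar

theorem theoremA1 (q m κ : ℝ) (hq : 1 ≤ q) (hm : 0 < m) (hκ : 0 < κ) (N : ℝ) (hN : 0 < N) :
    ∃ ρ : NeutronStar.R3 → ℝ, NeutronStar.IsMinimizer q m κ N ρ := by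
  have hq0 : 0 < q := by linarith
  obtain ⟨v, hv, hvN, hmin⟩ := NeutronStar.exists_minimizer
    (NeutronStar.kineticConst_pos hq0 hm) (half_pos hκ) hN
  have hadm := hv.isAdmissible hvN
  refine ⟨v, hadm, le_antisymm (le_iInf₂ fun ρ hρ => ?_) (iInf₂_le v hadm)⟩
  obtain ⟨u, hu, hae⟩ := hρ.exists_isSubDensity
  rw [NeutronStar.energy_congr_ae hae, NeutronStar.energy_eq_functional hq0 hu,
    NeutronStar.energy_eq_functional hq0 hv]
  exact EReal.coe_le_coe (hmin u hu)
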